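/- Let $S$ be a connected Riemann surface, $e\in S$, and let $\Psi: S\setminus\{e\}\to\widehat{\mathbb C}$ be a meromorphic function with an essential singularity at $e$ (that is, $\Psi$ does not extend meromorphically to $e$). Write $D(a,\rho)\subset\widehat{\mathbb C}$ for the open disk of centre $a$ and radius $\rho$ in the spherical metric. Let $a\in\widehat{\mathbb C}$, and let $U_a$ be a choice, for every $\rho>0$, of a connected component $U_a(\rho)\subset S\setminus\{e\}$ of $\Psi^{-1}(D(a,\rho))$ such that $U_a(\rho_1)\subset U_a(\rho_2)$ whenever $\rho_1<\rho_2$. The choice $U_a$ is called * an *algebraic singularity* of $\Psi^{-1}$ if $\bigcap_{\rho>0}U_a(\rho)=\{z_0\}$ for a critical point $z_0$ of $\Psi$ (that is, $\Psi(z_0)\in\mathbb C$ and $\Psi'(z_0)=0$, or $z_0$ is a multiple pole of $\Psi$); * a *transcendental singularity* of $\Psi^{-1}$ if $\bigcap_{\rho>0}U_a(\rho)=\varnothing$; * a *logarithmic singularity* if it is a transcendental singularity and for some $\rho>0$ the map $\Psi: U_a(\rho)\to D(a,\rho)\setminus\{a\}$ is a universal covering. A *singularity* of $\Psi^{-1}$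 is an algebraic or a transcendental one. A singularity $U_a$ is called *separate* if there is $\rho_1>0$ such that for every other singularity $U_b$ of $\Psi^{-1}$ (over any $b\in\widehat{\mathbb C}$, possibly $b=a$) there is $\rho_2>0$ with $U_a(\rho_1)\cap U_b(\rho_2)=\varnothing$. Let $U_a$ be a singularity of $\Psi^{-1}$ which, if it is transcendental, lies at $e$, in the sense that $e$ belongs to the closure of $U_a(\rho)$ for every $\rho>0$. Then $U_a$ is separate if and only if it is algebraic or logarithmic. -/

import Mathlib

open Set Filter Topology
open scoped Manifold

noncomputable section

/-- The spherical (geodesic) distance on the Riemann sphere `OnePoint ℂ`, realised as the unit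
sphere by stereographic projection: `2 arcsin` of half of the chordal distance. -/
def sphericalDist : OnePoint ℂ → OnePoint ℂ → ℝ
  | .some z, .some w =>
      2 * Real.arcsin (‖z - w‖ / (Real.sqrt (1 + ‖z‖ ^ 2) * Real.sqrt (1 + ‖w‖ ^ 2)))
  | .some z, .infty => 2 * Real.arcsin (1 / Real.sqrt (1 + ‖z‖ ^ 2))
  | .infty, .some w => 2 * Real.arcsin (1 / Real.sqrt (1 + ‖w‖ ^ 2))
  | .infty, .infty => 0

/-- The open disk of radius `ρ` centred at `a` in the spherical metric. -/
def sphericalDisk (a : OnePoint ℂ) (ρ : ℝ) : Set (OnePoint ℂ) :=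
  {t | sphericalDist t a < ρ}

/-- The chart at infinity of the Riemann sphere: `0 ↦ ∞` and `w ↦ 1 / w` for `w ≠ 0`. -/
def sphereInv (w : ℂ) : OnePoint ℂ :=
  open scoped Classical in if w = 0 then OnePoint.infty else ((w⁻¹ : ℂ) : OnePoint ℂ)

section

variable {S : Type*} [TopologicalSpace S] [ChartedSpace ℂ S]

/-- `Ψ` is holomorphic near `p` as a map to the Riemann sphere, that is, a meromorphic function
near `p`: in one of the two standard charts of the sphere it is a holomorphic function. -/
def MeromorphicNear (Ψ : S → OnePoint ℂ) (p : S) : Prop :=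
  ∃ g : S → ℂ, (∀ᶠ z in 𝓝 p, MDifferentiableAt 𝓘(ℂ) 𝓘(ℂ) g z) ∧
    ((∀ᶠ z in 𝓝 p, Ψ z = (g z : OnePoint ℂ)) ∨ (∀ᶠ z in 𝓝 p, Ψ z = sphereInv (g z)))

/-- `p` is a critical point of `Ψ`: either `Ψ` is finite at `p` with `Ψ' (p) = 0`, or `p` is a
multiple pole of `Ψ`, that is, `1 / Ψ` vanishes at `p` together with its derivative. -/
def IsCriticalPt (Ψ : S → OnePoint ℂ) (p : S) : Prop :=
  ∃ g : S → ℂ, (∀ᶠ z in 𝓝 p, MDifferentiableAt 𝓘(ℂ) 𝓘(ℂ) g z) ∧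
    mfderiv 𝓘(ℂ) 𝓘(ℂ) g p = 0 ∧
    ((∀ᶠ z in 𝓝 p, Ψ z = (g z : OnePoint ℂ)) ∨
      (g p = 0 ∧ ∀ᶠ z in 𝓝 p, Ψ z = sphereInv (g z)))

/-- `Ψ` is meromorphic on the surface `S` punctured at `e` and has an essential singularity at `e`:
no choice of a value at `e` makes it meromorphic there. The value `Ψ e` is irrelevant. -/
structure IsTranscendentalMeromorphic (e : S) (Ψ : S → OnePoint ℂ) : Prop where
  meromorphic : ∀ p : S, p ≠ e → MeromorphicNear Ψ p
  essential : ∀ Φ : S → OnePoint ℂ, (∀ p : S, p ≠ e → Φ p = Ψ p) → ¬ MeromorphicNear Φ e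

/-- The preimage of the spherical disk `D (a, ρ)` under `Ψ : S \ {e} → OnePoint ℂ`. -/
def diskPreimage (e : S) (Ψ : S → OnePoint ℂ) (a : OnePoint ℂ) (ρ : ℝ) : Set S :=
  {z | z ≠ e ∧ Ψ z ∈ sphericalDisk a ρ}

/-- A choice `ρ ↦ U (ρ)`, for `ρ > 0`, of a connected component of `Ψ⁻¹ (D (a, ρ))` in `S \ {e}`
that is monotone in `ρ`. -/
@[ext]
structure InverseGerm (e : S) (Ψ : S → OnePoint ℂ) where
  /-- The point `a` of the sphere over which the germ lies. -/
  base : OnePoint ℂ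
  /-- The component `U (ρ)`. -/
  nhd : Ioi (0 : ℝ) → Set S
  isComponent : ∀ ρ : Ioi (0 : ℝ), ∃ z ∈ diskPreimage e Ψ base ρ,
    nhd ρ = connectedComponentIn (diskPreimage e Ψ base ρ) z
  mono : ∀ ρ₁ ρ₂ : Ioi (0 : ℝ), ρ₁ < ρ₂ → nhd ρ₁ ⊆ nhd ρ₂

namespace InverseGerm

variable {e : S} {Ψ : S → OnePoint ℂ}

/-- The neighbourhoods shrink to a critical point of `Ψ`. -/
def IsAlgebraic (U : InverseGerm e Ψ) : Prop :=
  ∃ z₀ : S, ⋂ ρ, U.nhd ρ = {z₀} ∧ IsCriticalPt Ψ z₀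

/-- The neighbourhoods have empty intersection. -/
def IsTranscendental (U : InverseGerm e Ψ) : Prop :=
  ⋂ ρ, U.nhd ρ = ∅

/-- The singularities of the inverse of `Ψ`; what is excluded are the ordinary points. -/
def IsSingularity (U : InverseGerm e Ψ) : Prop :=
  U.IsAlgebraic ∨ U.IsTranscendental

/-- The neighbourhoods accumulate at the essential singularity `e`. -/
def AccumulatesAtEssential (U : InverseGerm e Ψ) : Prop :=
  ∀ ρ, e ∈ closure (U.nhd ρ)

/-- A transcendental singularity is logarithmic if, for some `ρ > 0`, the restriction
`Ψ : U (ρ) → D (a, ρ) \ {a}` is a universal covering. -/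
def IsLogarithmic (U : InverseGerm e Ψ) : Prop :=
  U.IsTranscendental ∧
    ∃ (ρ : Ioi (0 : ℝ)) (h : MapsTo Ψ (U.nhd ρ) (sphericalDisk U.base ρ \ {U.base})),
      IsCoveringMap h.restrict ∧ SimplyConnectedSpace (U.nhd ρ)

/-- Some neighbourhood `U (ρ₁)` is disjoint from a neighbourhood of every other singularity.
The radius `ρ₁` does not depend on the other singularity. -/
def IsSeparate (U : InverseGerm e Ψ) : Prop :=
  ∃ ρ₁, ∀ V : InverseGerm e Ψ, V.IsSingularity → V ≠ U →
    ∃ ρ₂, Disjoint (U.nhd ρ₁) (V.nhd ρ₂)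

end InverseGerm

end

end

/-! The sphere is handled through the coordinates `centeredPt a`, obtained from the standard one by
a rotation taking `0` to `a`. In them a disk `D(a, ρ)` with `ρ < π` is a Euclidean disk around `0`,
and `expPt a` (the exponential followed by `centeredPt a`) maps a left half-plane onto the punctured
disk as its universal covering. A germ either has empty intersection or shrinks to a single point
(`iInter_nhd_eq_singleton`), because `Ψ` is nowhere locally constant. Critical points are the points
where `Ψ` fails to be locally injective.

Algebraic implies separate: some `U(ρ₁)` lies in a compact neighbourhood of `z₀` avoiding `e`, where
`z₀` is the only possible critical point. A germ `V` that meets `U(ρ₁)` at all radii has, by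
compactness, a common point there. A singular such `V` is therefore algebraic at `z₀`, so it is `U`.

Separate and transcendental implies logarithmic: shrink `ρ` below `π`. A critical point in `U(ρ)`
would give a forbidden singularity, so `Ψ` is a local homeomorphism on `U(ρ)`. Paths in the
punctured disk lift (`hasPathLifts_of_separate`): a partial lift without a limit would define a
transcendental singularity over the endpoint that meets `U(ρ)` at all radii. Hence the exponential
covering lifts to a map `F` from the half-plane to `U(ρ)`. Continuing `F` along paths shows that it
hits everything over the punctured disk (`mem_range_lift`). A point of `U(ρ)` over `a` would lie in
every `U(ρ')`, contrary to transcendence, so `F` is onto. If `F` were not injective it would be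
periodic, and the part of `U(ρ)` over a smaller circle would be compact. A punctured neighbourhood
of `e` would then be trapped in a smaller `U(r)`, making `Ψ` bounded in a coordinate near `e` and
the singularity removable (`injective_lift`). So `F` is a homeomorphism and `U` is logarithmic.

Logarithmic implies separate: suppose `V` meets a smaller `U(r)` at all radii. Over the same base
point, the parts of `U(ρ)` over small concentric disks are connected, being images of half-planes,
so `V = U` (`eq_of_isCoveringMap`). Over another base point `b`, a small disk around `b` lifts to
`U(ρ)`, and `V` shrinks to the lift of `b` (`exists_mem_of_isCoveringMap`). That point is not
critical, so `V` is not a singularity. -/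

noncomputable section

open scoped ComplexConjugate unitInterval

/-! ### Rotations of the Riemann sphere -/

/-- The point of the Riemann sphere with homogeneous coordinates `[u : v]`. -/
def homogPt (u v : ℂ) : OnePoint ℂ :=
  open scoped Classical in if v = 0 then OnePoint.infty else ((u / v : ℂ) : OnePoint ℂ)

lemma homogPt_zero_right (u : ℂ) : homogPt u 0 = OnePoint.infty := by simp [homogPt]

lemma homogPt_of_ne {v : ℂ} (u : ℂ) (hv : v ≠ 0) :
    homogPt u v = ((u / v : ℂ) : OnePoint ℂ) := by simp [homogPt, hv]

lemma homogPt_mul {k : ℂ} (hk : k ≠ 0) (u v : ℂ) : homogPt (k * u) (k * v) = homogPt u v := by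
  by_cases hv : v = 0
  · simp [hv, homogPt_zero_right]
  · rw [homogPt_of_ne _ hv, homogPt_of_ne _ (mul_ne_zero hk hv), mul_div_mul_left _ _ hk]

lemma exists_homogPt (t : OnePoint ℂ) : ∃ u v : ℂ, (u ≠ 0 ∨ v ≠ 0) ∧ homogPt u v = t := by
  induction t using OnePoint.rec with
  | infty => exact ⟨1, 0, by simp, homogPt_zero_right _⟩
  | coe z => exact ⟨z, 1, by simp, by simp [homogPt]⟩

lemma sphereInv_eq_homogPt (w : ℂ) : sphereInv w = homogPt 1 w := by
  simp [sphereInv, homogPt]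

lemma continuous_sphereInv : Continuous sphereInv := by
  rw [continuous_iff_continuousAt]
  intro w
  by_cases hw : w = 0
  · subst hw
    have h0 : sphereInv 0 = OnePoint.infty := by simp [sphereInv]
    rw [continuousAt_iff_punctured_nhds, h0]
    have h1 : Tendsto (fun w : ℂ ↦ ((w⁻¹ : ℂ) : OnePoint ℂ)) (𝓝[≠] 0) (𝓝 OnePoint.infty) := by
      have h2 : Tendsto (fun w : ℂ ↦ w⁻¹) (𝓝[≠] 0) (Bornology.cobounded ℂ) :=
        tendsto_inv₀_nhdsNE_zero
      rw [Metric.cobounded_eq_cocompact, ← Filter.coclosedCompact_eq_cocompact] at h2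
      exact OnePoint.tendsto_coe_infty.comp h2
    refine h1.congr' ?_
    filter_upwards [self_mem_nhdsWithin] with w hw
    simp only [mem_compl_iff, mem_singleton_iff] at hw
    simp [sphereInv, hw]
  · have h1 : ContinuousAt (fun w : ℂ ↦ ((w⁻¹ : ℂ) : OnePoint ℂ)) w :=
      OnePoint.continuous_coe.continuousAt.comp (continuousAt_inv₀ hw)
    refine h1.congr ?_
    filter_upwards [isOpen_ne.mem_nhds hw] with z hz
    simp [sphereInv, hz]

lemma continuousAt_homogPt {p : ℂ × ℂ} (hp : p.1 ≠ 0 ∨ p.2 ≠ 0) :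
    ContinuousAt (fun q : ℂ × ℂ ↦ homogPt q.1 q.2) p := by
  rcases hp with hp | hp
  · have h1 : ContinuousAt (fun q : ℂ × ℂ ↦ sphereInv (q.2 / q.1)) p :=
      continuous_sphereInv.continuousAt.comp (continuousAt_snd.div continuousAt_fst hp)
    refine h1.congr ?_
    filter_upwards [(isOpen_ne.preimage continuous_fst).mem_nhds hp] with q hq
    have hq : q.1 ≠ 0 := hq
    rw [sphereInv_eq_homogPt, ← homogPt_mul hq]
    field_simp
  · have h1 : ContinuousAt (fun q : ℂ × ℂ ↦ ((q.1 / q.2 : ℂ) : OnePoint ℂ)) p :=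
      OnePoint.continuous_coe.continuousAt.comp (continuousAt_fst.div continuousAt_snd hp)
    refine h1.congr ?_
    filter_upwards [(isOpen_ne.preimage continuous_snd).mem_nhds hp] with q hq
    exact (homogPt_of_ne _ hq).symm

lemma sqrt_one_add_norm_div_sq (u : ℂ) {v : ℂ} (hv : v ≠ 0) :
    Real.sqrt (1 + ‖u / v‖ ^ 2) = Real.sqrt (‖u‖ ^ 2 + ‖v‖ ^ 2) / ‖v‖ := by
  have hv' : 0 < ‖v‖ := norm_pos_iff.2 hv
  rw [norm_div, ← Real.sqrt_sq hv'.le, ← Real.sqrt_div (by positivity), Real.sqrt_sq hv'.le]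
  congr 1
  field_simp
  ring

/-- Homogeneous coordinates absorb the case distinction at infinity, so that the effect of a
rotation on distances becomes an identity between linear forms. -/
lemma sphericalDist_homogPt {u v u' v' : ℂ} (h : u ≠ 0 ∨ v ≠ 0) (h' : u' ≠ 0 ∨ v' ≠ 0) :
    sphericalDist (homogPt u v) (homogPt u' v') =
      2 * Real.arcsin (‖u * v' - u' * v‖ /
        (Real.sqrt (‖u‖ ^ 2 + ‖v‖ ^ 2) * Real.sqrt (‖u'‖ ^ 2 + ‖v'‖ ^ 2))) := by
  by_cases hv : v = 0 <;> by_cases hv' : v' = 0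
  · subst hv hv'
    simp [homogPt_zero_right, sphericalDist]
  · subst hv
    have hu : 0 < ‖u‖ := norm_pos_iff.2 (by simpa using h)
    have hv'' : 0 < ‖v'‖ := norm_pos_iff.2 hv'
    rw [homogPt_zero_right, homogPt_of_ne _ hv']
    change 2 * Real.arcsin (1 / Real.sqrt (1 + ‖u' / v'‖ ^ 2)) = _
    rw [sqrt_one_add_norm_div_sq _ hv']
    congr 2
    simp only [norm_zero, mul_zero, sub_zero, norm_mul]
    rw [show ‖u‖ ^ 2 + (0 : ℝ) ^ 2 = ‖u‖ ^ 2 by ring, Real.sqrt_sq hu.le]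
    have : 0 < Real.sqrt (‖u'‖ ^ 2 + ‖v'‖ ^ 2) := by positivity
    field_simp
  · subst hv'
    have hu : 0 < ‖u'‖ := norm_pos_iff.2 (by simpa using h')
    have hv'' : 0 < ‖v‖ := norm_pos_iff.2 hv
    rw [homogPt_zero_right, homogPt_of_ne _ hv]
    change 2 * Real.arcsin (1 / Real.sqrt (1 + ‖u / v‖ ^ 2)) = _
    rw [sqrt_one_add_norm_div_sq _ hv]
    congr 2
    simp only [norm_zero, mul_zero, zero_sub, norm_neg, norm_mul]
    rw [show ‖u'‖ ^ 2 + (0 : ℝ) ^ 2 = ‖u'‖ ^ 2 by ring, Real.sqrt_sq hu.le]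
    have : 0 < Real.sqrt (‖u‖ ^ 2 + ‖v‖ ^ 2) := by positivity
    field_simp
  · rw [homogPt_of_ne _ hv, homogPt_of_ne _ hv']
    change 2 * Real.arcsin (‖u / v - u' / v'‖ /
      (Real.sqrt (1 + ‖u / v‖ ^ 2) * Real.sqrt (1 + ‖u' / v'‖ ^ 2))) = _
    rw [sqrt_one_add_norm_div_sq _ hv, sqrt_one_add_norm_div_sq _ hv']
    have e1 : u / v - u' / v' = (u * v' - u' * v) / (v * v') := by field_simp
    have hv1 : 0 < ‖v‖ := norm_pos_iff.2 hv
    have hv2 : 0 < ‖v'‖ := norm_pos_iff.2 hv'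
    have : 0 < Real.sqrt (‖u‖ ^ 2 + ‖v‖ ^ 2) := by positivity
    have : 0 < Real.sqrt (‖u'‖ ^ 2 + ‖v'‖ ^ 2) := by positivity
    rw [e1, norm_div, norm_mul]
    congr 2
    field_simp

/-- The Möbius transformation of the Riemann sphere given on homogeneous coordinates by the matrix
`!![c, d; -conj d, conj c]`; a rotation of the sphere unless `c = d = 0`. -/
def rotate (c d : ℂ) : OnePoint ℂ → OnePoint ℂ
  | .some w => homogPt (c * w + d) (conj c - conj d * w)
  | .infty => homogPt c (-conj d)

lemma normSq_add_ne_zero {c d : ℂ} (h : c ≠ 0 ∨ d ≠ 0) : c * conj c + d * conj d ≠ 0 := by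
  rw [Complex.mul_conj, Complex.mul_conj]
  norm_cast
  rcases h with h | h
  · exact (add_pos_of_pos_of_nonneg (Complex.normSq_pos.2 h) (Complex.normSq_nonneg _)).ne'
  · exact (add_pos_of_nonneg_of_pos (Complex.normSq_nonneg _) (Complex.normSq_pos.2 h)).ne'

lemma rotate_coords_ne {c d u v : ℂ} (h : c ≠ 0 ∨ d ≠ 0) (huv : u ≠ 0 ∨ v ≠ 0) :
    c * u + d * v ≠ 0 ∨ conj c * v - conj d * u ≠ 0 := by
  by_contra! hc
  have hN := normSq_add_ne_zero h
  have h1 : (c * conj c + d * conj d) * u = 0 := by linear_combination conj c * hc.1 - d * hc.2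
  have h2 : (c * conj c + d * conj d) * v = 0 := by linear_combination conj d * hc.1 + c * hc.2
  rcases huv with hu | hv
  · exact (mul_ne_zero hN hu) h1
  · exact (mul_ne_zero hN hv) h2

lemma rotate_homogPt {c d u v : ℂ} (huv : u ≠ 0 ∨ v ≠ 0) :
    rotate c d (homogPt u v) = homogPt (c * u + d * v) (conj c * v - conj d * u) := by
  by_cases hv : v = 0
  · subst hv
    have hu : u ≠ 0 := by simpa using huv
    rw [homogPt_zero_right]
    change homogPt c (-conj d) = _
    rw [← homogPt_mul hu]
    congr 1 <;> ring
  · rw [homogPt_of_ne _ hv]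
    change homogPt (c * (u / v) + d) (conj c - conj d * (u / v)) = _
    rw [← homogPt_mul hv]
    congr 1 <;> field_simp

/-- The two matrices multiply to the scalar `|c|² + |d|²`, which homogeneous coordinates ignore. -/
lemma rotate_rotate {c d : ℂ} (h : c ≠ 0 ∨ d ≠ 0) (t : OnePoint ℂ) :
    rotate (conj c) (-d) (rotate c d t) = t := by
  obtain ⟨u, v, huv, rfl⟩ := exists_homogPt t
  rw [rotate_homogPt huv, rotate_homogPt (rotate_coords_ne h huv),
    ← homogPt_mul (normSq_add_ne_zero h) u v]
  simp only [Complex.conj_conj, map_neg]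
  congr 1 <;> ring

lemma continuous_rotate {c d : ℂ} (h : c ≠ 0 ∨ d ≠ 0) : Continuous (rotate c d) := by
  rw [continuous_iff_continuousAt]
  intro t
  induction t using OnePoint.rec with
  | infty =>
    rw [OnePoint.continuousAt_infty']
    change Tendsto (fun w : ℂ ↦ homogPt (c * w + d) (conj c - conj d * w)) _
      (𝓝 (homogPt c (-conj d)))
    have h1 : Tendsto (fun w : ℂ ↦ w⁻¹) (coclosedCompact ℂ) (𝓝 0) := by
      rw [Filter.coclosedCompact_eq_cocompact, ← Metric.cobounded_eq_cocompact]
      exact tendsto_inv₀_cobounded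
    -- Near infinity divide both homogeneous coordinates by `w` and use `x = w⁻¹` as the variable.
    have h2 : ContinuousAt (fun x : ℂ ↦ homogPt (c + d * x) (conj c * x - conj d)) 0 := by
      refine ContinuousAt.comp (f := fun x : ℂ ↦ (c + d * x, conj c * x - conj d))
        (g := fun q : ℂ × ℂ ↦ homogPt q.1 q.2) (continuousAt_homogPt ?_) (by fun_prop)
      simpa using h
    have h3 := h2.tendsto.comp h1
    simp only [mul_zero, add_zero, zero_sub] at h3
    refine h3.congr' ?_
    have h4 : ∀ᶠ w : ℂ in coclosedCompact ℂ, w ≠ 0 := by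
      rw [Filter.coclosedCompact_eq_cocompact]
      exact (isCompact_singleton (x := (0 : ℂ))).compl_mem_cocompact
    filter_upwards [h4] with w hw
    simp only [Function.comp_apply]
    rw [← homogPt_mul hw]
    congr 1 <;> field_simp
  | coe w =>
    rw [OnePoint.continuousAt_coe]
    change ContinuousAt (fun w : ℂ ↦ homogPt (c * w + d) (conj c - conj d * w)) w
    refine ContinuousAt.comp (f := fun w : ℂ ↦ (c * w + d, conj c - conj d * w))
      (g := fun q : ℂ × ℂ ↦ homogPt q.1 q.2) (continuousAt_homogPt ?_) (by fun_prop)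
    simpa using rotate_coords_ne (u := w) (v := 1) h (by simp)

/-- A rotation of the Riemann sphere, as a homeomorphism. -/
def rotateHomeo (c d : ℂ) (h : c ≠ 0 ∨ d ≠ 0) : OnePoint ℂ ≃ₜ OnePoint ℂ where
  toFun := rotate c d
  invFun := rotate (conj c) (-d)
  left_inv := rotate_rotate h
  right_inv t := by
    simpa using rotate_rotate (c := conj c) (d := -d) (by simpa using h) t
  continuous_toFun := continuous_rotate h
  continuous_invFun := continuous_rotate (by simpa using h)

/-! ### Coordinates centred at a point of the sphere -/

/-- The first entry of the matrix of a rotation that moves `0` to `a`. -/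
def centerFst : OnePoint ℂ → ℂ
  | .some _ => 1
  | .infty => 0

/-- The second entry of the matrix of a rotation that moves `0` to `a`. -/
def centerSnd : OnePoint ℂ → ℂ
  | .some z => z
  | .infty => 1

lemma center_ne (a : OnePoint ℂ) : centerFst a ≠ 0 ∨ centerSnd a ≠ 0 := by
  induction a using OnePoint.rec with
  | infty => right; exact one_ne_zero
  | coe z => left; exact one_ne_zero

lemma homogPt_center (a : OnePoint ℂ) : homogPt (centerSnd a) (conj (centerFst a)) = a := by
  induction a using OnePoint.rec with
  | infty => simp [centerFst, homogPt]
  | coe z =>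
    change homogPt z (conj 1) = _
    simp [homogPt]

/-- The inverse of the holomorphic coordinate on the sphere obtained from the standard one by
a rotation that moves `0` to `a`. -/
def centeredPt (a : OnePoint ℂ) (w : ℂ) : OnePoint ℂ :=
  rotateHomeo (centerFst a) (centerSnd a) (center_ne a) (w : OnePoint ℂ)

lemma centeredPt_eq (a : OnePoint ℂ) (w : ℂ) : centeredPt a w =
    homogPt (centerFst a * w + centerSnd a) (conj (centerFst a) - conj (centerSnd a) * w) := rfl

lemma centeredPt_coords_ne (a : OnePoint ℂ) (w : ℂ) :
    centerFst a * w + centerSnd a ≠ 0 ∨ conj (centerFst a) - conj (centerSnd a) * w ≠ 0 := by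
  simpa using rotate_coords_ne (u := w) (v := 1) (center_ne a) (by simp)

lemma isOpenEmbedding_centeredPt (a : OnePoint ℂ) : IsOpenEmbedding (centeredPt a) :=
  (rotateHomeo (centerFst a) (centerSnd a) (center_ne a)).isOpenEmbedding.comp
    OnePoint.isOpenEmbedding_coe

lemma continuous_centeredPt (a : OnePoint ℂ) : Continuous (centeredPt a) :=
  (isOpenEmbedding_centeredPt a).continuous

lemma centeredPt_injective (a : OnePoint ℂ) : Function.Injective (centeredPt a) :=
  (isOpenEmbedding_centeredPt a).injective

@[simp] lemma centeredPt_zero (a : OnePoint ℂ) : centeredPt a 0 = a := by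
  simp [centeredPt_eq, homogPt_center]

lemma coe_eq_centeredPt (w : ℂ) : (w : OnePoint ℂ) = centeredPt ((0 : ℂ) : OnePoint ℂ) w := by
  rw [centeredPt_eq]
  change _ = homogPt (1 * w + 0) (conj 1 - conj 0 * w)
  simp [homogPt]

/-- The sign appears because the rotation taking `0` to infinity is `w ↦ -1 / w`. -/
lemma sphereInv_eq_centeredPt (w : ℂ) : sphereInv w = centeredPt OnePoint.infty (-w) := by
  rw [centeredPt_eq, sphereInv_eq_homogPt]
  change _ = homogPt (0 * -w + 1) (conj 0 - conj 1 * -w)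
  simp

/-- The matrix is a scalar multiple of a unitary one, so it scales the norm of the vector `(w, 1)`.
-/
lemma norm_sq_conj_sub (c d w : ℂ) :
    ‖c * w + d‖ ^ 2 + ‖conj c - conj d * w‖ ^ 2 = (‖c‖ ^ 2 + ‖d‖ ^ 2) * (1 + ‖w‖ ^ 2) := by
  simp only [← Complex.normSq_eq_norm_sq, Complex.normSq_apply]
  simp only [Complex.add_re, Complex.mul_re, Complex.add_im, Complex.mul_im, Complex.sub_re,
    Complex.conj_re, Complex.conj_im, Complex.sub_im]
  ring

lemma sphericalDist_centeredPt (a : OnePoint ℂ) (w : ℂ) :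
    sphericalDist (centeredPt a w) a = 2 * Real.arctan ‖w‖ := by
  have h0 : centerSnd a ≠ 0 ∨ conj (centerFst a) ≠ 0 := by
    simpa [or_comm] using center_ne a
  have key := sphericalDist_homogPt (centeredPt_coords_ne a w) h0
  rw [homogPt_center, ← centeredPt_eq] at key
  rw [key, Real.arctan_eq_arcsin, norm_sq_conj_sub]
  set c := centerFst a
  set d := centerSnd a
  have e1 : (c * w + d) * conj c - d * (conj c - conj d * w) =
      (c * conj c + d * conj d) * w := by ring
  have e2 : ‖c * conj c + d * conj d‖ = ‖c‖ ^ 2 + ‖d‖ ^ 2 := by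
    rw [Complex.mul_conj, Complex.mul_conj, ← Complex.ofReal_add, Complex.norm_real,
      Real.norm_of_nonneg (add_nonneg (Complex.normSq_nonneg _) (Complex.normSq_nonneg _)),
      Complex.normSq_eq_norm_sq, Complex.normSq_eq_norm_sq]
  have hN : 0 < ‖c‖ ^ 2 + ‖d‖ ^ 2 := by
    rw [← e2]; exact norm_pos_iff.2 (normSq_add_ne_zero (center_ne a))
  rw [e1, norm_mul, e2, Real.sqrt_mul hN.le, Complex.norm_conj, add_comm (‖d‖ ^ 2)]
  have hs : Real.sqrt (‖c‖ ^ 2 + ‖d‖ ^ 2) * Real.sqrt (‖c‖ ^ 2 + ‖d‖ ^ 2) =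
      ‖c‖ ^ 2 + ‖d‖ ^ 2 := Real.mul_self_sqrt hN.le
  have hs' : 0 < Real.sqrt (‖c‖ ^ 2 + ‖d‖ ^ 2) := Real.sqrt_pos.2 hN
  have hw : 0 < Real.sqrt (1 + ‖w‖ ^ 2) := by positivity
  congr 2
  rw [div_eq_div_iff (by positivity) hw.ne']
  linear_combination (-‖w‖ * Real.sqrt (1 + ‖w‖ ^ 2)) * hs

/-- The rotation is a bijection of the sphere, so the coordinate misses only the image of infinity,
the antipode of `a`. -/
lemma eq_of_notMem_range_centeredPt {a t : OnePoint ℂ} (ht : t ∉ range (centeredPt a)) :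
    t = homogPt (centerFst a) (-conj (centerSnd a)) := by
  obtain ⟨s, rfl⟩ := (rotateHomeo (centerFst a) (centerSnd a) (center_ne a)).surjective t
  induction s using OnePoint.rec with
  | infty => rfl
  | coe w => exact absurd ⟨w, rfl⟩ ht

lemma sphericalDist_of_notMem_range_centeredPt {a t : OnePoint ℂ}
    (ht : t ∉ range (centeredPt a)) : sphericalDist t a = Real.pi := by
  have h0 : centerSnd a ≠ 0 ∨ conj (centerFst a) ≠ 0 := by
    simpa [or_comm] using center_ne a
  have h1 : centerFst a ≠ 0 ∨ -conj (centerSnd a) ≠ 0 := by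
    simpa using center_ne a
  have key := sphericalDist_homogPt h1 h0
  rw [homogPt_center, ← eq_of_notMem_range_centeredPt ht] at key
  rw [key]
  set c := centerFst a
  set d := centerSnd a
  have e2 : ‖c * conj c - d * -conj d‖ = ‖c‖ ^ 2 + ‖d‖ ^ 2 := by
    rw [mul_neg, sub_neg_eq_add, Complex.mul_conj, Complex.mul_conj, ← Complex.ofReal_add,
      Complex.norm_real,
      Real.norm_of_nonneg (add_nonneg (Complex.normSq_nonneg _) (Complex.normSq_nonneg _)),
      Complex.normSq_eq_norm_sq, Complex.normSq_eq_norm_sq]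
  have hN : 0 < ‖c‖ ^ 2 + ‖d‖ ^ 2 := by
    have := norm_pos_iff.2 (normSq_add_ne_zero (center_ne a))
    rw [← e2]; simpa using this
  rw [e2, norm_neg, Complex.norm_conj, Complex.norm_conj, add_comm (‖d‖ ^ 2),
    Real.mul_self_sqrt hN.le, div_self hN.ne', Real.arcsin_one]
  ring

/-- The change of coordinates between two centred coordinates is holomorphic. -/
lemma exists_analyticAt_centeredPt_eq {a b : OnePoint ℂ} {w₀ w₁ : ℂ}
    (h : centeredPt a w₀ = centeredPt b w₁) :
    ∃ m : ℂ → ℂ, AnalyticAt ℂ m w₀ ∧ m w₀ = w₁ ∧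
      ∀ᶠ w in 𝓝 w₀, centeredPt a w = centeredPt b (m w) := by
  set N : ℂ → ℂ := fun w ↦ conj (centerFst b) * (centerFst a * w + centerSnd a) -
    centerSnd b * (conj (centerFst a) - conj (centerSnd a) * w) with hN
  set D : ℂ → ℂ := fun w ↦ conj (centerSnd b) * (centerFst a * w + centerSnd a) +
    centerFst b * (conj (centerFst a) - conj (centerSnd a) * w) with hD
  -- Undoing the rotation for `b` writes the change of coordinates as a quotient `N / D` of affine
  -- functions; `D` is nonzero at `w₀` because the value there is finite.
  have hrot : ∀ w, rotate (conj (centerFst b)) (-centerSnd b) (centeredPt a w) =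
      homogPt (N w) (D w) := by
    intro w
    rw [centeredPt_eq, rotate_homogPt (centeredPt_coords_ne a w)]
    simp only [hN, hD, Complex.conj_conj, map_neg]
    congr 1 <;> ring
  have hinv : ∀ w, rotate (centerFst b) (centerSnd b)
      (rotate (conj (centerFst b)) (-centerSnd b) w) = w := fun w ↦
    (rotateHomeo (centerFst b) (centerSnd b) (center_ne b)).apply_symm_apply w
  have h0 : homogPt (N w₀) (D w₀) = (w₁ : OnePoint ℂ) := by
    rw [← hrot, h]
    exact rotate_rotate (center_ne b) (w₁ : OnePoint ℂ)
  have hD0 : D w₀ ≠ 0 := by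
    intro h1
    rw [h1, homogPt_zero_right] at h0
    exact OnePoint.infty_ne_coe _ h0
  have hDa : AnalyticAt ℂ D w₀ := by
    apply Differentiable.analyticAt; fun_prop
  have hNa : AnalyticAt ℂ N w₀ := by
    apply Differentiable.analyticAt; fun_prop
  refine ⟨fun w ↦ N w / D w, hNa.div hDa hD0, ?_, ?_⟩
  · rw [homogPt_of_ne _ hD0] at h0
    exact OnePoint.coe_injective h0
  · filter_upwards [hDa.continuousAt.eventually_ne hD0] with w hw
    rw [← hinv (centeredPt a w), hrot, homogPt_of_ne _ hw]
    rfl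

/-! ### Spherical disks -/

lemma centeredPt_mem_sphericalDisk {a : OnePoint ℂ} {w : ℂ} {ρ : ℝ} :
    centeredPt a w ∈ sphericalDisk a ρ ↔ 2 * Real.arctan ‖w‖ < ρ := by
  simp [sphericalDisk, sphericalDist_centeredPt]

lemma center_mem_sphericalDisk (a : OnePoint ℂ) {ρ : ℝ} (hρ : 0 < ρ) : a ∈ sphericalDisk a ρ := by
  have := centeredPt_mem_sphericalDisk (a := a) (w := 0) (ρ := ρ)
  simpa [hρ] using this

lemma sphericalDisk_mono (a : OnePoint ℂ) {ρ₁ ρ₂ : ℝ} (h : ρ₁ ≤ ρ₂) :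
    sphericalDisk a ρ₁ ⊆ sphericalDisk a ρ₂ := fun _ ht ↦ lt_of_lt_of_le ht h

lemma sphericalDisk_subset_range {a : OnePoint ℂ} {ρ : ℝ} (hρ : ρ ≤ Real.pi) :
    sphericalDisk a ρ ⊆ range (centeredPt a) := by
  intro t ht
  by_contra h
  have h1 : sphericalDist t a < ρ := ht
  rw [sphericalDist_of_notMem_range_centeredPt h] at h1
  linarith

lemma two_mul_arctan_lt_iff {x ρ : ℝ} (hρ : 0 < ρ) (hρ' : ρ < Real.pi) :
    2 * Real.arctan x < ρ ↔ x < Real.tan (ρ / 2) := by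
  have h1 : Real.arctan (Real.tan (ρ / 2)) = ρ / 2 :=
    Real.arctan_tan (by linarith) (by linarith)
  rw [← Real.arctan_strictMono.lt_iff_lt (a := x), h1]
  constructor <;> intro h <;> linarith

lemma sphericalDisk_eq_image {a : OnePoint ℂ} {ρ : ℝ} (hρ : 0 < ρ) (hρ' : ρ < Real.pi) :
    sphericalDisk a ρ = centeredPt a '' Metric.ball 0 (Real.tan (ρ / 2)) := by
  ext t
  constructor
  · intro ht
    obtain ⟨w, rfl⟩ := sphericalDisk_subset_range hρ'.le ht
    rw [centeredPt_mem_sphericalDisk, two_mul_arctan_lt_iff hρ hρ'] at ht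
    exact ⟨w, by simpa using ht, rfl⟩
  · rintro ⟨w, hw, rfl⟩
    rw [centeredPt_mem_sphericalDisk, two_mul_arctan_lt_iff hρ hρ']
    simpa using hw

lemma tan_half_pos {ρ : ℝ} (hρ : 0 < ρ) (hρ' : ρ < Real.pi) : 0 < Real.tan (ρ / 2) :=
  Real.tan_pos_of_pos_of_lt_pi_div_two (by linarith) (by linarith)

/-- The antipode is at distance `π`: up to that radius the disk lies in the coordinate domain,
beyond it the disk is the whole sphere. -/
lemma isOpen_sphericalDisk (a : OnePoint ℂ) (ρ : ℝ) : IsOpen (sphericalDisk a ρ) := by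
  rcases le_or_gt ρ Real.pi with hρ | hρ
  · have : sphericalDisk a ρ = centeredPt a '' {w | 2 * Real.arctan ‖w‖ < ρ} := by
      ext t
      constructor
      · intro ht
        obtain ⟨w, rfl⟩ := sphericalDisk_subset_range hρ ht
        exact ⟨w, centeredPt_mem_sphericalDisk.1 ht, rfl⟩
      · rintro ⟨w, hw, rfl⟩
        exact centeredPt_mem_sphericalDisk.2 hw
    rw [this]
    refine (isOpenEmbedding_centeredPt a).isOpenMap _ (isOpen_lt ?_ continuous_const)
    exact continuous_const.mul (Real.continuous_arctan.comp continuous_norm)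
  · have : sphericalDisk a ρ = univ := by
      refine eq_univ_of_forall fun t ↦ ?_
      by_cases ht : t ∈ range (centeredPt a)
      · obtain ⟨w, rfl⟩ := ht
        rw [centeredPt_mem_sphericalDisk]
        linarith [Real.arctan_lt_pi_div_two ‖w‖]
      · change sphericalDist t a < ρ
        rwa [sphericalDist_of_notMem_range_centeredPt ht]
    rw [this]
    exact isOpen_univ

lemma sphericalDisk_mem_nhds (a : OnePoint ℂ) {ρ : ℝ} (hρ : 0 < ρ) :
    sphericalDisk a ρ ∈ 𝓝 a :=
  (isOpen_sphericalDisk a ρ).mem_nhds (center_mem_sphericalDisk a hρ)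

lemma exists_sphericalDisk_subset {a : OnePoint ℂ} {N : Set (OnePoint ℂ)} (hN : N ∈ 𝓝 a) :
    ∃ ρ, 0 < ρ ∧ ρ < Real.pi ∧ sphericalDisk a ρ ⊆ N := by
  have h1 : centeredPt a ⁻¹' N ∈ 𝓝 (0 : ℂ) :=
    (continuous_centeredPt a).continuousAt.preimage_mem_nhds (by simpa using hN)
  obtain ⟨ε, hε, hεN⟩ := Metric.mem_nhds_iff.1 h1
  have h2 : 0 < Real.arctan ε := Real.arctan_pos.2 hε
  have h3 := Real.arctan_lt_pi_div_two ε
  refine ⟨2 * Real.arctan ε, by linarith, by linarith, ?_⟩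
  rw [sphericalDisk_eq_image (by linarith) (by linarith), mul_div_cancel_left₀ _ two_ne_zero,
    Real.tan_arctan]
  exact image_subset_iff.2 hεN

lemma isClosed_sphericalDist_le (a : OnePoint ℂ) {r : ℝ} (hr : 0 < r) (hr' : r < Real.pi) :
    IsClosed {t | sphericalDist t a ≤ r} := by
  have : {t | sphericalDist t a ≤ r} = centeredPt a '' Metric.closedBall 0 (Real.tan (r / 2)) := by
    ext t
    have hat : Real.arctan (Real.tan (r / 2)) = r / 2 :=
      Real.arctan_tan (by linarith) (by linarith)
    have hiff : ∀ w : ℂ, 2 * Real.arctan ‖w‖ ≤ r ↔ ‖w‖ ≤ Real.tan (r / 2) := by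
      intro w
      rw [← Real.arctan_strictMono.le_iff_le (a := ‖w‖), hat]
      constructor <;> intro h <;> linarith
    constructor
    · intro ht
      have h1 : t ∈ range (centeredPt a) := by
        by_contra h
        have h2 : sphericalDist t a ≤ r := ht
        rw [sphericalDist_of_notMem_range_centeredPt h] at h2
        linarith
      obtain ⟨w, rfl⟩ := h1
      have h2 : sphericalDist (centeredPt a w) a ≤ r := ht
      rw [sphericalDist_centeredPt, hiff] at h2
      exact ⟨w, by simpa using h2, rfl⟩
    · rintro ⟨w, hw, rfl⟩
      change sphericalDist (centeredPt a w) a ≤ r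
      rw [sphericalDist_centeredPt, hiff]
      simpa using hw
  rw [this]
  exact ((isCompact_closedBall _ _).image (continuous_centeredPt a)).isClosed

lemma sphericalDist_pos {a t : OnePoint ℂ} (h : t ≠ a) : 0 < sphericalDist t a := by
  by_cases ht : t ∈ range (centeredPt a)
  · obtain ⟨w, rfl⟩ := ht
    rw [sphericalDist_centeredPt]
    have : w ≠ 0 := by rintro rfl; simp at h
    have := Real.arctan_pos.2 (norm_pos_iff.2 this)
    linarith
  · rw [sphericalDist_of_notMem_range_centeredPt ht]
    exact Real.pi_pos

/-! ### Holomorphic functions of one variable -/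

/-- Zeros of the derivative are isolated unless it vanishes near `z₀`, which would make `f` constant
there. -/
lemma AnalyticAt.eventually_deriv_ne_zero {f : ℂ → ℂ} {z₀ : ℂ} (hf : AnalyticAt ℂ f z₀)
    (hne : ¬ ∀ᶠ z in 𝓝 z₀, f z = f z₀) : ∀ᶠ z in 𝓝[≠] z₀, deriv f z ≠ 0 := by
  refine hf.deriv.eventually_eq_zero_or_eventually_ne_zero.resolve_left fun h0 ↦ hne ?_
  obtain ⟨ε, hε, hball⟩ := Metric.eventually_nhds_iff_ball.1 (h0.and hf.eventually_analyticAt)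
  refine Metric.eventually_nhds_iff_ball.2 ⟨ε, hε, fun z hz ↦ ?_⟩
  exact Metric.isOpen_ball.is_const_of_deriv_eq_zero Metric.isPreconnected_ball
    (fun y hy ↦ (hball y hy).2.differentiableAt.differentiableWithinAt)
    (fun y hy ↦ (hball y hy).1) hz (Metric.mem_ball_self hε)

lemma AnalyticAt.exists_injOn_of_deriv_ne_zero {f : ℂ → ℂ} {z₀ : ℂ} (hf : AnalyticAt ℂ f z₀)
    (hd : deriv f z₀ ≠ 0) : ∃ N ∈ 𝓝 z₀, InjOn f N := by
  have h := hf.hasStrictDerivAt.hasStrictFDerivAt_equiv hd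
  exact ⟨_, h.toOpenPartialHomeomorph.open_source.mem_nhds h.mem_toOpenPartialHomeomorph_source,
    h.toOpenPartialHomeomorph.injOn⟩

lemma not_eventually_eq_of_injOn {X Y : Type*} [TopologicalSpace X] {f : X → Y} {x : X}
    [(𝓝[≠] x).NeBot] {N : Set X} (hN : N ∈ 𝓝 x) (hinj : InjOn f N) :
    ¬ ∀ᶠ z in 𝓝 x, f z = f x := by
  intro h
  have h1 : ∀ᶠ z in 𝓝[≠] x, False := by
    filter_upwards [nhdsWithin_le_nhds h, nhdsWithin_le_nhds hN, self_mem_nhdsWithin] with z h1 h2 h3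
    exact h3 (hinj h2 (mem_of_mem_nhds hN) h1)
  exact h1.exists.elim fun _ h ↦ h

/-- A holomorphic function that is injective near a point has a nonzero derivative there. -/
lemma AnalyticAt.deriv_ne_zero_of_injOn {f : ℂ → ℂ} {z₀ : ℂ} (hf : AnalyticAt ℂ f z₀)
    {N : Set ℂ} (hN : N ∈ 𝓝 z₀) (hinj : InjOn f N) : deriv f z₀ ≠ 0 := by
  have hnc : ∀ z ∈ interior N, ¬ ∀ᶠ y in 𝓝 z, f y = f z := fun z hz ↦
    not_eventually_eq_of_injOn (mem_interior_iff_mem_nhds.1 hz) hinj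
  have hz₀ : z₀ ∈ interior N := mem_interior_iff_mem_nhds.2 hN
  have hd : ∀ᶠ z in 𝓝 z₀, z ≠ z₀ → deriv f z ≠ 0 :=
    eventually_nhdsWithin_iff.1 (hf.eventually_deriv_ne_zero (hnc _ hz₀))
  obtain ⟨r, hr, hball⟩ := Metric.eventually_nhds_iff_ball.1
    ((hd.and hf.eventually_analyticAt).and (isOpen_interior.mem_nhds hz₀))
  set B := Metric.ball z₀ r
  have hB : IsOpen B := Metric.isOpen_ball
  have hinjB : InjOn f B := hinj.mono fun z hz ↦ interior_subset (hball z hz).2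
  have hopen : ∀ z ∈ B, ∀ M ∈ 𝓝 z, f '' M ∈ 𝓝 (f z) := fun z hz M hM ↦
    ((hball z hz).1.2.eventually_constant_or_nhds_le_map_nhds.resolve_left
      (hnc z (hball z hz).2)) (image_mem_map hM)
  set g : ℂ → ℂ := Function.invFunOn f B
  have hg : ∀ z ∈ B, g (f z) = z := fun z hz ↦ hinjB.leftInvOn_invFunOn hz
  have hgc : ∀ z ∈ B, ContinuousAt g (f z) := by
    intro z hz M hM
    rw [hg z hz] at hM
    rw [mem_map]
    refine mem_of_superset (hopen z hz _ (inter_mem hM (hB.mem_nhds hz))) ?_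
    rintro _ ⟨y, hy, rfl⟩
    simpa only [mem_preimage, hg y hy.2] using hy.1
  have hfg : ∀ z ∈ B, ∀ᶠ y in 𝓝 (f z), f (g y) = y := by
    intro z hz
    refine mem_of_superset (hopen z hz _ (hB.mem_nhds hz)) ?_
    rintro _ ⟨y, hy, rfl⟩
    simp only [mem_ofPred_eq, hg y hy]
  have hz₀B : z₀ ∈ B := Metric.mem_ball_self hr
  -- The local inverse is continuous, and differentiable off `f z₀` since the derivative of `f`
  -- vanishes at most at `z₀`. The singularity at `f z₀` is removable, and the chain rule for `g ∘ f
  -- = id` concludes.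
  have hga : AnalyticAt ℂ g (f z₀) := by
    refine Complex.analyticAt_of_differentiable_on_punctured_nhds_of_continuousAt ?_ (hgc z₀ hz₀B)
    rw [eventually_nhdsWithin_iff]
    refine mem_of_superset (hopen z₀ hz₀B _ (hB.mem_nhds hz₀B)) ?_
    rintro _ ⟨y, hy, rfl⟩ hne
    have hy' : y ≠ z₀ := fun h ↦ hne (by simp [h])
    refine (HasDerivAt.of_local_left_inverse (f := f) (f' := deriv f y) (hgc y hy) ?_
      ((hball y hy).1.1 hy') (hfg y hy)).differentiableAt
    rw [hg y hy]
    exact (hball y hy).1.2.differentiableAt.hasDerivAt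
  have hcomp : HasDerivAt (g ∘ f) (deriv g (f z₀) * deriv f z₀) z₀ :=
    hga.differentiableAt.hasDerivAt.comp z₀ hf.differentiableAt.hasDerivAt
  have hid : HasDerivAt (g ∘ f) 1 z₀ := by
    refine (hasDerivAt_id z₀).congr_of_eventuallyEq ?_
    filter_upwards [hB.mem_nhds hz₀B] with z hz using hg z hz
  have := hcomp.unique hid
  exact right_ne_zero_of_mul_eq_one this

lemma ball_diff_singleton_eq_image_exp (z₀ : ℂ) {R : ℝ} (hR : 0 < R) :
    Metric.ball z₀ R \ {z₀} = (fun s ↦ z₀ + Complex.exp s) '' {s | s.re < Real.log R} := by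
  ext z
  constructor
  · rintro ⟨hz, hne⟩
    have hne' : z - z₀ ≠ 0 := sub_ne_zero.2 hne
    refine ⟨Complex.log (z - z₀), ?_, by simp [Complex.exp_log hne']⟩
    rw [mem_ofPred_eq, Complex.log_re]
    exact Real.log_lt_log (norm_pos_iff.2 hne') (by simpa [dist_eq_norm] using hz)
  · rintro ⟨s, hs, rfl⟩
    refine ⟨?_, by simp [Complex.exp_ne_zero]⟩
    simp only [Metric.mem_ball, dist_eq_norm, add_sub_cancel_left, Complex.norm_exp]
    exact (Real.lt_log_iff_exp_lt hR).1 hs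

lemma isPathConnected_ball_diff_singleton (z₀ : ℂ) {R : ℝ} (hR : 0 < R) :
    IsPathConnected (Metric.ball z₀ R \ {z₀}) := by
  rw [ball_diff_singleton_eq_image_exp z₀ hR]
  refine IsPathConnected.image ?_ (by fun_prop)
  refine (convex_halfSpace_re_lt _).isPathConnected ⟨(Real.log R - 1 : ℝ), ?_⟩
  simp

/-! ### Meromorphic functions in local coordinates -/

section Surface

variable {S : Type*} [TopologicalSpace S] [ChartedSpace ℂ S]

lemma nhdsNE_neBot_of_chartedSpace (p : S) : (𝓝[≠] p).NeBot := by
  set φ := chartAt ℂ p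
  by_contra h
  rw [not_neBot, ← isOpen_singleton_iff_punctured_nhds] at h
  have h1 := φ.isOpen_image_of_subset_source h (singleton_subset_iff.2 (mem_chart_source ℂ p))
  rw [image_singleton] at h1
  exact not_isOpen_singleton _ h1

lemma mdifferentiableAt_iff_chartAt [IsManifold 𝓘(ℂ) 1 S] {g : S → ℂ} {p q : S}
    (hq : q ∈ (chartAt ℂ p).source) :
    MDifferentiableAt 𝓘(ℂ) 𝓘(ℂ) g q ↔
      DifferentiableAt ℂ (g ∘ (chartAt ℂ p).symm) (chartAt ℂ p q) := by
  rw [mdifferentiableAt_iff_source_of_mem_source hq]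
  simp [mdifferentiableWithinAt_univ, mdifferentiableAt_iff_differentiableAt]

lemma eventually_nhds_iff_chartAt {p : S} {P : S → Prop} :
    (∀ᶠ z in 𝓝 p, P z) ↔ ∀ᶠ w in 𝓝 (chartAt ℂ p p), P ((chartAt ℂ p).symm w) := by
  rw [(chartAt ℂ p).eventually_nhds' P (mem_chart_source ℂ p)]

lemma eventually_mdifferentiableAt_iff [IsManifold 𝓘(ℂ) 1 S] {g : S → ℂ} {p : S} :
    (∀ᶠ z in 𝓝 p, MDifferentiableAt 𝓘(ℂ) 𝓘(ℂ) g z) ↔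
      AnalyticAt ℂ (g ∘ (chartAt ℂ p).symm) (chartAt ℂ p p) := by
  rw [Complex.analyticAt_iff_eventually_differentiableAt, eventually_nhds_iff_chartAt]
  refine eventually_congr ?_
  filter_upwards [(chartAt ℂ p).open_target.mem_nhds (mem_chart_target ℂ p)] with w hw
  rw [mdifferentiableAt_iff_chartAt (p := p) ((chartAt ℂ p).map_target hw),
    (chartAt ℂ p).right_inv hw]

lemma mfderiv_eq_zero_iff [IsManifold 𝓘(ℂ) 1 S] {g : S → ℂ} {p : S}
    (hg : MDifferentiableAt 𝓘(ℂ) 𝓘(ℂ) g p) :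
    mfderiv 𝓘(ℂ) 𝓘(ℂ) g p = 0 ↔
      deriv (g ∘ (chartAt ℂ p).symm) (chartAt ℂ p p) = 0 := by
  have h : mfderiv 𝓘(ℂ) 𝓘(ℂ) g p =
      fderiv ℂ (g ∘ (chartAt ℂ p).symm) (chartAt ℂ p p) := by
    rw [hg.mfderiv]
    simp [writtenInExtChartAt]
    rfl
  constructor
  · intro h0
    have h1 : fderiv ℂ (g ∘ (chartAt ℂ p).symm) (chartAt ℂ p p) = 0 := h.symm.trans h0
    rw [← fderiv_apply_one_eq_deriv, h1]
    rfl
  · intro h0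
    refine h.trans ?_
    rw [← toSpanSingleton_deriv, h0]
    exact ContinuousLinearMap.toSpanSingleton_zero ℂ

variable {Ψ : S → OnePoint ℂ} {p : S}

lemma analyticAt_comp_chartAt {g : S → ℂ} {m : ℂ → ℂ}
    (hg : AnalyticAt ℂ (g ∘ (chartAt ℂ p).symm) (chartAt ℂ p p)) (hm : AnalyticAt ℂ m (g p)) :
    AnalyticAt ℂ ((m ∘ g) ∘ (chartAt ℂ p).symm) (chartAt ℂ p p) := by
  rw [Function.comp_assoc]
  refine AnalyticAt.comp ?_ hg
  simpa using hm

/-- The chart is injective on its source and `centeredPt b` everywhere, so local injectivity passes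
between `Ψ` and its coordinate expression. -/
lemma exists_injOn_chartAt_iff {b : OnePoint ℂ} {G : ℂ → ℂ} {q : S}
    (hq : q ∈ (chartAt ℂ p).source)
    (hΨ : ∀ᶠ z in 𝓝 q, Ψ z = centeredPt b (G (chartAt ℂ p z))) :
    (∃ N ∈ 𝓝 q, InjOn Ψ N) ↔ ∃ N ∈ 𝓝 (chartAt ℂ p q), InjOn G N := by
  set φ := chartAt ℂ p
  constructor
  · rintro ⟨N, hN, hinj⟩
    have hM := inter_mem (inter_mem hN hΨ) (φ.open_source.mem_nhds hq)
    refine ⟨φ '' _, φ.image_mem_nhds hq hM, ?_⟩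
    rintro _ ⟨x, ⟨⟨hx1, hx2⟩, hx3⟩, rfl⟩ _ ⟨y, ⟨⟨hy1, hy2⟩, hy3⟩, rfl⟩ hxy
    have hx2 : Ψ x = centeredPt b (G (φ x)) := hx2
    have hy2 : Ψ y = centeredPt b (G (φ y)) := hy2
    rw [hinj hx1 hy1 (by rw [hx2, hy2, hxy])]
  · rintro ⟨N, hN, hinj⟩
    have hM := inter_mem (inter_mem ((φ.continuousAt hq).preimage_mem_nhds hN) hΨ)
      (φ.open_source.mem_nhds hq)
    refine ⟨_, hM, ?_⟩
    rintro x ⟨⟨hx1, hx2⟩, hx3⟩ y ⟨⟨hy1, hy2⟩, hy3⟩ hxy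
    have hx2 : Ψ x = centeredPt b (G (φ x)) := hx2
    have hy2 : Ψ y = centeredPt b (G (φ y)) := hy2
    rw [hx2, hy2] at hxy
    exact φ.injOn hx3 hy3 (hinj hx1 hy1 (centeredPt_injective b hxy))

variable [IsManifold 𝓘(ℂ) 1 S]

/-- A function that is meromorphic near `p` is holomorphic in any coordinate of the sphere whose
domain contains the value at `p`. -/
lemma MeromorphicNear.exists_centeredPt (h : MeromorphicNear Ψ p) {b : OnePoint ℂ} {w₀ : ℂ}
    (hb : Ψ p = centeredPt b w₀) :
    ∃ g : S → ℂ, AnalyticAt ℂ (g ∘ (chartAt ℂ p).symm) (chartAt ℂ p p) ∧ g p = w₀ ∧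
      ∀ᶠ z in 𝓝 p, Ψ z = centeredPt b (g z) := by
  have key : ∃ (c : OnePoint ℂ) (g : S → ℂ),
      AnalyticAt ℂ (g ∘ (chartAt ℂ p).symm) (chartAt ℂ p p) ∧
        ∀ᶠ z in 𝓝 p, Ψ z = centeredPt c (g z) := by
    obtain ⟨g, hg, h | h⟩ := h
    · refine ⟨((0 : ℂ) : OnePoint ℂ), g, eventually_mdifferentiableAt_iff.1 hg, ?_⟩
      filter_upwards [h] with z hz
      rw [hz, coe_eq_centeredPt]
    · refine ⟨OnePoint.infty, fun z ↦ -g z, (eventually_mdifferentiableAt_iff.1 hg).neg, ?_⟩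
      filter_upwards [h] with z hz
      rw [hz, sphereInv_eq_centeredPt]
  obtain ⟨c, g, hg, hΨ⟩ := key
  obtain ⟨m, hm, hm0, hmeq⟩ := exists_analyticAt_centeredPt_eq (hΨ.self_of_nhds.symm.trans hb)
  refine ⟨m ∘ g, analyticAt_comp_chartAt hg hm, hm0, ?_⟩
  have hgc : ContinuousAt g p := (eventually_mdifferentiableAt_iff.2 hg).self_of_nhds.continuousAt
  filter_upwards [hΨ, hgc.eventually hmeq] with z h1 h2
  rw [h1, h2]
  rfl

/-- Returns from rotated coordinates to the two standard charts used in `MeromorphicNear` and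
`IsCriticalPt`; the change of coordinates `m` is kept explicit for the chain rule. -/
lemma exists_coe_or_sphereInv_of_centeredPt {b : OnePoint ℂ} {g : S → ℂ}
    (hg : AnalyticAt ℂ (g ∘ (chartAt ℂ p).symm) (chartAt ℂ p p))
    (hΨ : ∀ᶠ z in 𝓝 p, Ψ z = centeredPt b (g z)) :
    ∃ m : ℂ → ℂ, AnalyticAt ℂ m (g p) ∧ ((∀ᶠ z in 𝓝 p, Ψ z = (m (g z) : OnePoint ℂ)) ∨
      (m (g p) = 0 ∧ ∀ᶠ z in 𝓝 p, Ψ z = sphereInv (m (g z)))) := by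
  have hgc : ContinuousAt g p := (eventually_mdifferentiableAt_iff.2 hg).self_of_nhds.continuousAt
  rcases em (Ψ p = OnePoint.infty) with h0 | h0
  · have h1 : centeredPt b (g p) = centeredPt OnePoint.infty 0 := by
      rw [centeredPt_zero, ← h0, hΨ.self_of_nhds]
    obtain ⟨m, hm, hm0, hmeq⟩ := exists_analyticAt_centeredPt_eq h1
    refine ⟨fun w ↦ -m w, hm.neg, Or.inr ⟨by simp [hm0], ?_⟩⟩
    filter_upwards [hΨ, hgc.eventually hmeq] with z h2 h3
    rw [h2, h3, sphereInv_eq_centeredPt, neg_neg]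
  · obtain ⟨w, hw⟩ := OnePoint.ne_infty_iff_exists.1 h0
    have h1 : centeredPt b (g p) = centeredPt ((0 : ℂ) : OnePoint ℂ) w := by
      rw [← coe_eq_centeredPt, hw, hΨ.self_of_nhds]
    obtain ⟨m, hm, hm0, hmeq⟩ := exists_analyticAt_centeredPt_eq h1
    refine ⟨m, hm, Or.inl ?_⟩
    filter_upwards [hΨ, hgc.eventually hmeq] with z h2 h3
    rw [h2, h3, ← coe_eq_centeredPt]

lemma meromorphicNear_of_centeredPt {b : OnePoint ℂ} {g : S → ℂ}
    (hg : AnalyticAt ℂ (g ∘ (chartAt ℂ p).symm) (chartAt ℂ p p))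
    (hΨ : ∀ᶠ z in 𝓝 p, Ψ z = centeredPt b (g z)) : MeromorphicNear Ψ p := by
  obtain ⟨m, hm, h⟩ := exists_coe_or_sphereInv_of_centeredPt hg hΨ
  refine ⟨m ∘ g, eventually_mdifferentiableAt_iff.2 (analyticAt_comp_chartAt hg hm), ?_⟩
  exact h.imp id fun h ↦ h.2

/-- The local normal form: in the chart at `p` and the coordinate centred at `Ψ p`, a meromorphic
function is a holomorphic function vanishing at `p`. -/
lemma MeromorphicNear.exists_analyticAt (h : MeromorphicNear Ψ p) :
    ∃ G : ℂ → ℂ, AnalyticAt ℂ G (chartAt ℂ p p) ∧ G (chartAt ℂ p p) = 0 ∧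
      ∀ᶠ z in 𝓝 p, Ψ z = centeredPt (Ψ p) (G (chartAt ℂ p z)) := by
  obtain ⟨g, hg, hg0, hΨ⟩ := h.exists_centeredPt (centeredPt_zero (Ψ p)).symm
  refine ⟨g ∘ (chartAt ℂ p).symm, hg, by simp [hg0], ?_⟩
  filter_upwards [hΨ, (chartAt ℂ p).open_source.mem_nhds (mem_chart_source ℂ p)] with z h1 h2
  simp [h1, (chartAt ℂ p).left_inv h2]

lemma MeromorphicNear.continuousAt (h : MeromorphicNear Ψ p) : ContinuousAt Ψ p := by
  obtain ⟨G, hG, -, hΨ⟩ := h.exists_analyticAt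
  refine ContinuousAt.congr (f := fun z ↦ centeredPt (Ψ p) (G (chartAt ℂ p z))) ?_
    (hΨ.mono fun _ h ↦ h.symm)
  refine (continuous_centeredPt _).continuousAt.comp (ContinuousAt.comp hG.continuousAt ?_)
  exact (chartAt ℂ p).continuousAt (mem_chart_source ℂ p)

/-- The critical points are the points near which the function is not injective. -/
lemma IsCriticalPt.not_injOn (h : IsCriticalPt Ψ p) : ¬ ∃ N ∈ 𝓝 p, InjOn Ψ N := by
  have key : ∃ (c : OnePoint ℂ) (g : S → ℂ),
      AnalyticAt ℂ (g ∘ (chartAt ℂ p).symm) (chartAt ℂ p p) ∧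
      deriv (g ∘ (chartAt ℂ p).symm) (chartAt ℂ p p) = 0 ∧
        ∀ᶠ z in 𝓝 p, Ψ z = centeredPt c (g z) := by
    obtain ⟨g, hg, hd, h⟩ := h
    have hg' := eventually_mdifferentiableAt_iff.1 hg
    rw [mfderiv_eq_zero_iff hg.self_of_nhds] at hd
    rcases h with h | ⟨-, h⟩
    · refine ⟨((0 : ℂ) : OnePoint ℂ), g, hg', hd, ?_⟩
      filter_upwards [h] with z hz
      rw [hz, coe_eq_centeredPt]
    · refine ⟨OnePoint.infty, fun z ↦ -g z, hg'.neg, ?_, ?_⟩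
      · have : (fun z ↦ -g z) ∘ (chartAt ℂ p).symm = -(g ∘ (chartAt ℂ p).symm) := rfl
        rw [this, deriv.neg, hd, neg_zero]
      · filter_upwards [h] with z hz
        rw [hz, sphereInv_eq_centeredPt]
  obtain ⟨c, g, hg, hd, hΨ⟩ := key
  rw [exists_injOn_chartAt_iff (b := c) (G := g ∘ (chartAt ℂ p).symm) (mem_chart_source ℂ p)]
  · rintro ⟨N, hN, hinj⟩
    exact hg.deriv_ne_zero_of_injOn hN hinj hd
  · filter_upwards [hΨ, (chartAt ℂ p).open_source.mem_nhds (mem_chart_source ℂ p)] with z h1 h2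
    simp [h1, (chartAt ℂ p).left_inv h2]

lemma MeromorphicNear.isCriticalPt_of_not_injOn (h : MeromorphicNear Ψ p)
    (hinj : ¬ ∃ N ∈ 𝓝 p, InjOn Ψ N) : IsCriticalPt Ψ p := by
  obtain ⟨g, hg, hg0, hΨ⟩ := h.exists_centeredPt (centeredPt_zero (Ψ p)).symm
  have hd : deriv (g ∘ (chartAt ℂ p).symm) (chartAt ℂ p p) = 0 := by
    by_contra hd
    refine hinj ((exists_injOn_chartAt_iff (b := Ψ p) (G := g ∘ (chartAt ℂ p).symm)
      (mem_chart_source ℂ p) ?_).2 (hg.exists_injOn_of_deriv_ne_zero hd))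
    filter_upwards [hΨ, (chartAt ℂ p).open_source.mem_nhds (mem_chart_source ℂ p)] with z h1 h2
    simp [h1, (chartAt ℂ p).left_inv h2]
  obtain ⟨m, hm, hmΨ⟩ := exists_coe_or_sphereInv_of_centeredPt hg hΨ
  have hmg := eventually_mdifferentiableAt_iff.2 (analyticAt_comp_chartAt hg hm)
  refine ⟨m ∘ g, hmg, ?_, hmΨ⟩
  rw [mfderiv_eq_zero_iff hmg.self_of_nhds, Function.comp_assoc]
  have hm' : HasDerivAt m (deriv m (g p)) ((g ∘ (chartAt ℂ p).symm) (chartAt ℂ p p)) := by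
    simpa using hm.differentiableAt.hasDerivAt
  have := hm'.comp _ hg.differentiableAt.hasDerivAt
  rw [this.deriv, hd, mul_zero]

/-- Unless it is constant near `p`, a meromorphic function is injective near all points of
a punctured neighbourhood of `p`. -/
lemma MeromorphicNear.eventually_injOn (h : MeromorphicNear Ψ p)
    (hne : ¬ ∀ᶠ z in 𝓝 p, Ψ z = Ψ p) : ∀ᶠ q in 𝓝[≠] p, ∃ N ∈ 𝓝 q, InjOn Ψ N := by
  obtain ⟨G, hG, hG0, hΨ⟩ := h.exists_analyticAt
  set φ := chartAt ℂ p
  have hp : p ∈ φ.source := mem_chart_source ℂ p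
  have hφ : ContinuousAt φ p := φ.continuousAt hp
  have hGne : ¬ ∀ᶠ z in 𝓝 (φ p), G z = G (φ p) := by
    intro h0
    refine hne ?_
    filter_upwards [hΨ, hφ.eventually h0] with z h1 h2
    rw [h1, h2, hG0, centeredPt_zero]
  have hd := eventually_nhdsWithin_iff.1 (hG.eventually_deriv_ne_zero hGne)
  rw [eventually_nhdsWithin_iff]
  filter_upwards [hφ.eventually (hd.and hG.eventually_analyticAt), φ.open_source.mem_nhds hp,
    hΨ.eventually_nhds] with q h1 h2 h3 hqp
  have hne : φ q ≠ φ p := fun h ↦ hqp (φ.injOn h2 hp h)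
  exact (exists_injOn_chartAt_iff h2 h3).2 (h1.2.exists_injOn_of_deriv_ne_zero (h1.1 hne))

lemma MeromorphicNear.eventually_ne (h : MeromorphicNear Ψ p)
    (hne : ¬ ∀ᶠ z in 𝓝 p, Ψ z = Ψ p) : ∀ᶠ q in 𝓝[≠] p, Ψ q ≠ Ψ p := by
  obtain ⟨G, hG, hG0, hΨ⟩ := h.exists_analyticAt
  set φ := chartAt ℂ p
  have hp : p ∈ φ.source := mem_chart_source ℂ p
  have hφ : ContinuousAt φ p := φ.continuousAt hp
  have h1 := hG.eventually_eq_zero_or_eventually_ne_zero.resolve_left fun h0 ↦ hne (by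
    filter_upwards [hΨ, hφ.eventually h0] with z h1 h2
    rw [h1, h2, centeredPt_zero])
  rw [eventually_nhdsWithin_iff] at h1 ⊢
  filter_upwards [hφ.eventually h1, φ.open_source.mem_nhds hp, hΨ] with q h1 h2 h3 hqp h4
  refine h1 (fun h ↦ hqp (φ.injOn h2 hp h)) (centeredPt_injective (Ψ p) ?_)
  rw [← h3, h4, centeredPt_zero]

lemma MeromorphicNear.image_mem_nhds (h : MeromorphicNear Ψ p)
    (hne : ¬ ∀ᶠ z in 𝓝 p, Ψ z = Ψ p) {N : Set S} (hN : N ∈ 𝓝 p) : Ψ '' N ∈ 𝓝 (Ψ p) := by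
  obtain ⟨G, hG, hG0, hΨ⟩ := h.exists_analyticAt
  set φ := chartAt ℂ p
  have hp : p ∈ φ.source := mem_chart_source ℂ p
  have hφ : ContinuousAt φ p := φ.continuousAt hp
  have h1 := hG.eventually_constant_or_nhds_le_map_nhds.resolve_left fun h0 ↦ hne (by
    filter_upwards [hΨ, hφ.eventually h0] with z h1 h2
    rw [h1, h2, hG0, centeredPt_zero])
  have h2 := φ.image_mem_nhds hp (inter_mem hN hΨ)
  have h3 := (isOpenEmbedding_centeredPt (Ψ p)).isOpenMap.image_mem_nhds (h1 (image_mem_map h2))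
  rw [hG0, centeredPt_zero] at h3
  refine mem_of_superset h3 ?_
  rintro _ ⟨_, ⟨_, ⟨z, ⟨hz, hz'⟩, rfl⟩, rfl⟩, rfl⟩
  exact ⟨z, hz, hz'⟩

end Surface

/-! ### Behaviour near the essential singularity: identity theorem and removable singularities -/

section Surface

variable {S : Type*} [TopologicalSpace S] [ChartedSpace ℂ S] {Ψ : S → OnePoint ℂ} {p e : S}

/-- Every neighbourhood of a point of a surface contains an open neighbourhood that stays
connected when the point is removed. -/
lemma exists_isPreconnected_diff_singleton {N : Set S} (hN : N ∈ 𝓝 e) :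
    ∃ W ⊆ N, IsOpen W ∧ e ∈ W ∧ IsPreconnected (W \ {e}) := by
  set φ := chartAt ℂ e
  have he : e ∈ φ.source := mem_chart_source ℂ e
  have h1 : φ.target ∩ φ.symm ⁻¹' N ∈ 𝓝 (φ e) := by
    refine inter_mem (φ.open_target.mem_nhds (φ.map_source he))
      ((φ.continuousAt_symm (φ.map_source he)).preimage_mem_nhds ?_)
    rwa [φ.left_inv he]
  obtain ⟨R, hR, hball⟩ := Metric.mem_nhds_iff.1 h1
  have hsub : Metric.ball (φ e) R ⊆ φ.target := fun w hw ↦ (hball hw).1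
  refine ⟨φ.symm '' Metric.ball (φ e) R, ?_, ?_, ?_, ?_⟩
  · rintro _ ⟨w, hw, rfl⟩
    exact (hball hw).2
  · exact φ.isOpen_image_symm_of_subset_target Metric.isOpen_ball hsub
  · exact ⟨φ e, Metric.mem_ball_self hR, φ.left_inv he⟩
  · have : φ.symm '' Metric.ball (φ e) R \ {e} = φ.symm '' (Metric.ball (φ e) R \ {φ e}) := by
      ext z
      constructor
      · rintro ⟨⟨w, hw, rfl⟩, hne⟩
        refine ⟨w, ⟨hw, fun h ↦ hne ?_⟩, rfl⟩
        rw [mem_singleton_iff] at h ⊢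
        rw [h, φ.left_inv he]
      · rintro ⟨w, ⟨hw, hne⟩, rfl⟩
        refine ⟨⟨w, hw, rfl⟩, fun h ↦ hne ?_⟩
        rw [mem_singleton_iff] at h ⊢
        rw [← h, φ.right_inv (hsub hw)]
    rw [this]
    exact (isPathConnected_ball_diff_singleton _ hR).isConnected.isPreconnected.image _
      (φ.continuousOn_symm.mono (sdiff_subset.trans hsub))

variable [IsManifold 𝓘(ℂ) 1 S]

lemma MeromorphicNear.eventually_not_eventually_eq (h : MeromorphicNear Ψ p)
    (hne : ¬ ∀ᶠ z in 𝓝 p, Ψ z = Ψ p) : ∀ᶠ q in 𝓝 p, ¬ ∀ᶠ z in 𝓝 q, Ψ z = Ψ q := by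
  filter_upwards [eventually_nhdsWithin_iff.1 (h.eventually_injOn hne)] with q hq
  by_cases hqp : q = p
  · rwa [hqp]
  · obtain ⟨N, hN, hinj⟩ := hq hqp
    have := nhdsNE_neBot_of_chartedSpace q
    exact not_eventually_eq_of_injOn hN hinj

namespace IsTranscendentalMeromorphic

/-- A meromorphic function with an essential singularity is nowhere locally constant. -/
theorem not_eventually_eq [ConnectedSpace S] [T1Space S] (hΨ : IsTranscendentalMeromorphic e Ψ)
    (hp : p ≠ e) : ¬ ∀ᶠ z in 𝓝 p, Ψ z = Ψ p := by
  intro hconst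
  -- Points of local constancy and the remaining points are both open in the punctured surface.
  -- Connectedness is available only for `S`, so the behaviour of `A` near `e` has to be settled
  -- first.
  set A : Set S := {q | q ≠ e ∧ ∀ᶠ z in 𝓝 q, Ψ z = Ψ q} with hA
  set B : Set S := {q | q ≠ e ∧ ¬ ∀ᶠ z in 𝓝 q, Ψ z = Ψ q} with hB
  have hAo : IsOpen A := by
    rw [isOpen_iff_mem_nhds]
    rintro q ⟨hq, hqc⟩
    filter_upwards [isOpen_ne.mem_nhds hq, hqc.eventually_nhds, hqc] with z h1 h2 h3
    exact ⟨h1, by simpa only [h3] using h2⟩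
  have hBo : IsOpen B := by
    rw [isOpen_iff_mem_nhds]
    rintro q ⟨hq, hqc⟩
    filter_upwards [isOpen_ne.mem_nhds hq,
      (hΨ.meromorphic q hq).eventually_not_eventually_eq hqc] with z h1 h2 using ⟨h1, h2⟩
  have hAB : Disjoint A B := disjoint_left.2 fun q h1 h2 ↦ h2.2 h1.2
  obtain ⟨W, -, hWo, heW, hWc⟩ := exists_isPreconnected_diff_singleton (univ_mem (f := 𝓝 e))
  have hWAB : W \ {e} ⊆ A ∪ B := by
    rintro q ⟨-, hq⟩
    by_cases h : ∀ᶠ z in 𝓝 q, Ψ z = Ψ q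
    · exact Or.inl ⟨hq, h⟩
    · exact Or.inr ⟨hq, h⟩
  -- If `A` meets the connected set `W \ {e}`, it contains it, and `Ψ` is constant near `e`, hence
  -- extends. Otherwise `A` stays away from `e` and is clopen in `S`.
  by_cases hne : ((W \ {e}) ∩ A).Nonempty
  · have hWA := hWc.subset_left_of_subset_union hAo hBo hAB hWAB hne
    obtain ⟨q₀, hq₀, -⟩ := hne
    have hc : W \ {e} ⊆ {z | ∀ᶠ y in 𝓝 z, Ψ y = Ψ q₀} := by
      refine hWc.subset_left_of_subset_union (v := {z | ∀ᶠ y in 𝓝 z, Ψ y ≠ Ψ q₀})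
        isOpen_setOfPred_eventually_nhds isOpen_setOfPred_eventually_nhds ?_ ?_ ⟨q₀, hq₀, (hWA hq₀).2⟩
      · exact disjoint_left.2 fun z h1 h2 ↦ h2.self_of_nhds h1.self_of_nhds
      · intro z hz
        by_cases h : Ψ z = Ψ q₀
        · left
          have := (hWA hz).2
          rwa [h] at this
        · right
          exact (hWA hz).2.mono fun y hy ↦ by rwa [hy]
    classical
    refine hΨ.essential (Function.update Ψ e (Ψ q₀)) (fun z hz ↦ by simp [hz]) ?_
    refine meromorphicNear_of_centeredPt (b := Ψ q₀) (g := fun _ ↦ 0) analyticAt_const ?_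
    filter_upwards [hWo.mem_nhds heW] with z hz
    rw [centeredPt_zero]
    by_cases hze : z = e
    · simp [hze]
    · have h1 : ∀ᶠ y in 𝓝 z, Ψ y = Ψ q₀ := hc ⟨hz, hze⟩
      simpa [hze] using h1.self_of_nhds
  · have hAcl : IsClosed A := by
      rw [← isOpen_compl_iff, isOpen_iff_mem_nhds]
      intro q hq
      by_cases hqe : q = e
      · subst hqe
        filter_upwards [hWo.mem_nhds heW] with z hz hzA
        exact hne ⟨z, ⟨hz, hzA.1⟩, hzA⟩
      · have hqB : q ∈ B := ⟨hqe, fun h ↦ hq ⟨hqe, h⟩⟩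
        exact mem_of_superset (hBo.mem_nhds hqB) fun z h1 h2 ↦ disjoint_left.1 hAB h2 h1
    have huniv : A = univ := IsClopen.eq_univ ⟨hAcl, hAo⟩ ⟨p, hp, hconst⟩
    have : e ∈ A := huniv ▸ mem_univ e
    exact this.1 rfl

/-- A meromorphic function does not stay in a small disk near an essential singularity. -/
theorem not_eventually_mem_sphericalDisk (hΨ : IsTranscendentalMeromorphic e Ψ)
    {a : OnePoint ℂ} {r : ℝ} (hr : 0 < r) (hr' : r < Real.pi) :
    ¬ ∀ᶠ z in 𝓝[≠] e, Ψ z ∈ sphericalDisk a r := by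
  intro hmem
  set φ := chartAt ℂ e
  have he : e ∈ φ.source := mem_chart_source ℂ e
  rw [sphericalDisk_eq_image hr hr', eventually_nhdsWithin_iff] at hmem
  -- The coordinate of `Ψ` centred at `a`. The default values of `invFun` do not matter, since near
  -- `e` the values of `Ψ` lie in the range of the coordinate.
  set w : S → ℂ := fun z ↦ Function.invFun (centeredPt a) (Ψ z)
  have hw : ∀ v, Function.invFun (centeredPt a) (centeredPt a v) = v :=
    Function.leftInverse_invFun (centeredPt_injective a)
  set s : Set ℂ := {v | φ.symm v ∈ φ.source ∧ v ∈ φ.target ∧ (φ.symm v ≠ e → Ψ (φ.symm v) ∈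
    centeredPt a '' Metric.ball 0 (Real.tan (r / 2)))} with hs
  have hsn : s ∈ 𝓝 (φ e) := by
    have h1 := eventually_nhds_iff_chartAt.1 (hmem.and (φ.open_source.mem_nhds he))
    filter_upwards [h1, φ.open_target.mem_nhds (φ.map_source he)] with v hv hv'
    exact ⟨hv.2, hv', hv.1⟩
  have hse : ∀ v ∈ s \ {φ e}, φ.symm v ≠ e := by
    rintro v ⟨hv, hne⟩ h
    refine hne ?_
    rw [mem_singleton_iff, ← h, φ.right_inv hv.2.1]
  have hd : DifferentiableOn ℂ (w ∘ φ.symm) (s \ {φ e}) := by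
    intro v hv
    have hq := hse v hv
    obtain ⟨u, -, hu⟩ := hv.1.2.2 hq
    obtain ⟨g, hg, hg0, hgΨ⟩ := (hΨ.meromorphic _ hq).exists_centeredPt hu.symm
    have hmd : MDifferentiableAt 𝓘(ℂ) 𝓘(ℂ) w (φ.symm v) := by
      refine (eventually_mdifferentiableAt_iff.2 hg).self_of_nhds.congr_of_eventuallyEq ?_
      filter_upwards [hgΨ] with z hz
      simp only [w, hz, hw]
    rw [mdifferentiableAt_iff_chartAt (p := e) hv.1.1] at hmd
    rw [φ.right_inv hv.1.2.1] at hmd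
    exact hmd.differentiableWithinAt
  have hb : BddAbove (norm ∘ (w ∘ φ.symm) '' (s \ {φ e})) := by
    refine ⟨Real.tan (r / 2), ?_⟩
    rintro _ ⟨v, hv, rfl⟩
    obtain ⟨u, hu, hu'⟩ := hv.1.2.2 (hse v hv)
    simp only [Function.comp_apply, w, ← hu', hw]
    exact (mem_ball_zero_iff.1 hu).le
  -- Riemann's removable singularity theorem: the coordinate of `Ψ` is bounded by `tan (r / 2)`.
  have hdiff := Complex.differentiableOn_update_limUnder_of_bddAbove hsn hd hb
  set f := Function.update (w ∘ φ.symm) (φ e) (limUnder (𝓝[≠] (φ e)) (w ∘ φ.symm)) with hf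
  classical
  refine hΨ.essential (Function.update Ψ e (centeredPt a (f (φ e)))) (fun z hz ↦ by simp [hz]) ?_
  refine meromorphicNear_of_centeredPt (b := a) (g := f ∘ φ) ?_ ?_
  · have h1 : AnalyticAt ℂ f (φ e) := hdiff.analyticAt hsn
    refine h1.congr ?_
    filter_upwards [φ.open_target.mem_nhds (φ.map_source he)] with v hv
    exact (congrArg f (φ.right_inv hv)).symm
  · filter_upwards [hmem, φ.open_source.mem_nhds he] with z hz hz'
    by_cases hze : z = e
    · simp [hze]
    · have hne : φ z ≠ φ e := fun h ↦ hze (φ.injOn hz' he h)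
      obtain ⟨u, hu, hu'⟩ := hz hze
      simp only [ne_eq, hze, not_false_eq_true, Function.update_of_ne, Function.comp_apply, hf, hne,
        φ.left_inv hz', w, ← hu', hw]

end IsTranscendentalMeromorphic

end Surface

section Surface

variable {S : Type*} {Ψ : S → OnePoint ℂ} {p e : S}

/-! ### Components of preimages of disks -/

lemma eq_of_forall_mem_sphericalDisk {a t : OnePoint ℂ}
    (h : ∀ ρ : Ioi (0 : ℝ), t ∈ sphericalDisk a ρ) : t = a := by
  by_contra hne
  have h1 := sphericalDist_pos hne
  have h2 : sphericalDist t a < sphericalDist t a := h ⟨_, h1⟩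
  exact lt_irrefl _ h2

lemma diskPreimage_mono (b : OnePoint ℂ) {ρ₁ ρ₂ : ℝ} (h : ρ₁ ≤ ρ₂) :
    diskPreimage e Ψ b ρ₁ ⊆ diskPreimage e Ψ b ρ₂ :=
  fun _ hz ↦ ⟨hz.1, sphericalDisk_mono b h hz.2⟩

variable [TopologicalSpace S]

namespace InverseGerm

lemma nhd_subset (U : InverseGerm e Ψ) (ρ : Ioi (0 : ℝ)) :
    U.nhd ρ ⊆ diskPreimage e Ψ U.base ρ := by
  obtain ⟨z, -, h⟩ := U.isComponent ρ
  rw [h]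
  exact connectedComponentIn_subset _ _

lemma nonempty_nhd (U : InverseGerm e Ψ) (ρ : Ioi (0 : ℝ)) : (U.nhd ρ).Nonempty := by
  obtain ⟨z, hz, h⟩ := U.isComponent ρ
  rw [h]
  exact ⟨z, mem_connectedComponentIn hz⟩

lemma isPreconnected_nhd (U : InverseGerm e Ψ) (ρ : Ioi (0 : ℝ)) : IsPreconnected (U.nhd ρ) := by
  obtain ⟨z, -, h⟩ := U.isComponent ρ
  rw [h]
  exact isPreconnected_connectedComponentIn

lemma nhd_eq_of_mem (U : InverseGerm e Ψ) {ρ : Ioi (0 : ℝ)} {x : S} (hx : x ∈ U.nhd ρ) :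
    U.nhd ρ = connectedComponentIn (diskPreimage e Ψ U.base ρ) x := by
  obtain ⟨z, -, h⟩ := U.isComponent ρ
  rw [h] at hx ⊢
  exact connectedComponentIn_eq hx

lemma nhd_mono (U : InverseGerm e Ψ) {ρ₁ ρ₂ : Ioi (0 : ℝ)} (h : ρ₁ ≤ ρ₂) :
    U.nhd ρ₁ ⊆ U.nhd ρ₂ := by
  rcases h.eq_or_lt with rfl | h
  · rfl
  · exact U.mono _ _ h

lemma subset_nhd (U : InverseGerm e Ψ) {ρ : Ioi (0 : ℝ)} {T : Set S} (hT : IsPreconnected T)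
    (hT' : T ⊆ diskPreimage e Ψ U.base ρ) (hne : (T ∩ U.nhd ρ).Nonempty) : T ⊆ U.nhd ρ := by
  obtain ⟨x, hxT, hxU⟩ := hne
  rw [U.nhd_eq_of_mem hxU]
  exact hT.subset_connectedComponentIn hxT hT'

/-- Two components of the same preimage that meet are equal. -/
lemma eq_of_forall_inter_nonempty {U V : InverseGerm e Ψ} (hb : V.base = U.base)
    (h : ∀ ρ, (V.nhd ρ ∩ U.nhd ρ).Nonempty) : V = U := by
  refine InverseGerm.ext hb (funext fun ρ ↦ Subset.antisymm ?_ ?_)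
  · exact U.subset_nhd (V.isPreconnected_nhd ρ) (hb ▸ V.nhd_subset ρ) (h ρ)
  · exact V.subset_nhd (U.isPreconnected_nhd ρ) (hb ▸ U.nhd_subset ρ) (inter_comm _ _ ▸ h ρ)

lemma eq_base_of_mem_iInter (V : InverseGerm e Ψ) {x : S} (hx : ∀ ρ, x ∈ V.nhd ρ) :
    Ψ x = V.base :=
  eq_of_forall_mem_sphericalDisk fun ρ ↦ (V.nhd_subset ρ (hx ρ)).2

/-- The germ formed by the components that contain a given point. -/
def ofPoint (Ψ : S → OnePoint ℂ) (hp : p ≠ e) : InverseGerm e Ψ where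
  base := Ψ p
  nhd ρ := connectedComponentIn (diskPreimage e Ψ (Ψ p) ρ) p
  isComponent ρ := ⟨p, ⟨hp, center_mem_sphericalDisk _ ρ.2⟩, rfl⟩
  mono _ _ h := connectedComponentIn_mono _ (diskPreimage_mono _ h.le)

lemma mem_ofPoint_nhd (hp : p ≠ e) (ρ : Ioi (0 : ℝ)) : p ∈ (ofPoint Ψ hp).nhd ρ :=
  mem_connectedComponentIn ⟨hp, center_mem_sphericalDisk _ ρ.2⟩

end InverseGerm

variable [ChartedSpace ℂ S] [IsManifold 𝓘(ℂ) 1 S]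

namespace IsTranscendentalMeromorphic

variable (hΨ : IsTranscendentalMeromorphic e Ψ)
include hΨ

lemma continuousAt (hp : p ≠ e) : ContinuousAt Ψ p := (hΨ.meromorphic p hp).continuousAt

lemma injOn_of_not_isCriticalPt (hp : p ≠ e) (h : ¬ IsCriticalPt Ψ p) :
    ∃ N ∈ 𝓝 p, InjOn Ψ N := by
  by_contra hinj
  exact h ((hΨ.meromorphic p hp).isCriticalPt_of_not_injOn hinj)

lemma isOpen_diskPreimage [T1Space S] (b : OnePoint ℂ) (ρ : ℝ) :
    IsOpen (diskPreimage e Ψ b ρ) := by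
  rw [isOpen_iff_mem_nhds]
  rintro z ⟨hz, hzD⟩
  exact inter_mem (isOpen_ne.mem_nhds hz)
    ((hΨ.continuousAt hz).preimage_mem_nhds ((isOpen_sphericalDisk b ρ).mem_nhds hzD))

lemma isOpen_connectedComponentIn [T1Space S] (b : OnePoint ℂ) (ρ : ℝ) (z : S) :
    IsOpen (connectedComponentIn (diskPreimage e Ψ b ρ) z) := by
  have := ChartedSpace.locallyConnectedSpace ℂ S
  exact (hΨ.isOpen_diskPreimage b ρ).connectedComponentIn

lemma isOpen_nhd [T1Space S] (U : InverseGerm e Ψ) (ρ : Ioi (0 : ℝ)) : IsOpen (U.nhd ρ) := by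
  obtain ⟨z, -, h⟩ := U.isComponent ρ
  rw [h]
  exact hΨ.isOpen_connectedComponentIn _ _ _

/-- Components of the preimage are open and disjoint, so each of them is also closed relative to the
preimage. -/
lemma mem_nhd_of_mem_closure [T1Space S] (U : InverseGerm e Ψ) {ρ : Ioi (0 : ℝ)} {x : S}
    (hx : x ∈ closure (U.nhd ρ)) (hxD : x ∈ diskPreimage e Ψ U.base ρ) : x ∈ U.nhd ρ := by
  refine U.subset_nhd isPreconnected_connectedComponentIn (connectedComponentIn_subset _ x) ?_
    (mem_connectedComponentIn hxD)
  exact mem_closure_iff.1 hx _ (hΨ.isOpen_connectedComponentIn _ _ _)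
    (mem_connectedComponentIn hxD)

/-- If all neighbourhoods of a germ meet a compact set, they have a common point there. -/
lemma exists_mem_of_isCompact [T2Space S] (V : InverseGerm e Ψ) {K : Set S} (hK : IsCompact K)
    (heK : e ∉ K) (hV : ∀ ρ, (V.nhd ρ ∩ K).Nonempty) : ∃ x ∈ K, ∀ ρ, x ∈ V.nhd ρ := by
  -- Closures are taken to get nested compact sets. The common point then lies over the base by
  -- continuity, so it belongs to the components themselves.
  have h1 : (⋂ ρ : Ioi (0 : ℝ), K ∩ closure (V.nhd ρ)).Nonempty := by
    have : Nonempty (Ioi (0 : ℝ)) := ⟨⟨1, mem_Ioi.2 one_pos⟩⟩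
    refine IsCompact.nonempty_iInter_of_directed_nonempty_isCompact_isClosed _ ?_ ?_ ?_ ?_
    · intro ρ₁ ρ₂
      refine ⟨min ρ₁ ρ₂, ?_, ?_⟩
      · exact inter_subset_inter_right _ (closure_mono (V.nhd_mono (min_le_left _ _)))
      · exact inter_subset_inter_right _ (closure_mono (V.nhd_mono (min_le_right _ _)))
    · intro ρ
      obtain ⟨x, hx, hxK⟩ := hV ρ
      exact ⟨x, hxK, subset_closure hx⟩
    · exact fun ρ ↦ hK.inter_right isClosed_closure
    · exact fun ρ ↦ hK.isClosed.inter isClosed_closure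
  obtain ⟨x, hx⟩ := h1
  rw [mem_iInter] at hx
  have hxK : x ∈ K := (hx ⟨1, mem_Ioi.2 one_pos⟩).1
  have hxe : x ≠ e := fun h ↦ heK (h ▸ hxK)
  have hxb : Ψ x = V.base := by
    by_contra hne
    obtain ⟨N₁, N₂, hN₁, hN₂, hx₁, hb₂, hdis⟩ := t2_separation hne
    obtain ⟨ρ, hρ, -, hρN⟩ := exists_sphericalDisk_subset (hN₂.mem_nhds hb₂)
    obtain ⟨y, hy₁, hy₂⟩ := mem_closure_iff_nhds.1 (hx ⟨ρ, hρ⟩).2 _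
      ((hΨ.continuousAt hxe).preimage_mem_nhds (hN₁.mem_nhds hx₁))
    exact disjoint_left.1 hdis hy₁ (hρN (V.nhd_subset _ hy₂).2)
  exact ⟨x, hxK, fun ρ ↦ hΨ.mem_nhd_of_mem_closure V (hx ρ).2
    ⟨hxe, hxb ▸ center_mem_sphericalDisk _ ρ.2⟩⟩

variable [T2Space S] [ConnectedSpace S]

/-- The components of the preimages of small disks that contain a given point are small. -/
lemma exists_connectedComponentIn_subset (hp : p ≠ e) {N : Set S} (hN : N ∈ 𝓝 p) :
    ∃ ρ, 0 < ρ ∧ connectedComponentIn (diskPreimage e Ψ (Ψ p) ρ) p ⊆ N := by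
  have := ChartedSpace.locallyCompactSpace ℂ S
  have h1 := eventually_nhdsWithin_iff.1
    ((hΨ.meromorphic p hp).eventually_ne (hΨ.not_eventually_eq hp))
  obtain ⟨K, hKn, hKsub, hK⟩ := local_compact_nhds
    (inter_mem (inter_mem hN h1) (isOpen_ne.mem_nhds hp))
  have hpK : p ∈ interior K := mem_interior_iff_mem_nhds.2 hKn
  -- On this compact set `Ψ` avoids the value `Ψ p`, hence also a disk around it. A component over
  -- that disk cannot cross `F` and stays in the interior of `K`.
  set F := K \ interior K with hF
  have hFc : IsCompact F := hK.diff isOpen_interior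
  have hΨF : IsCompact (Ψ '' F) := hFc.image_of_continuousOn fun z hz ↦
    (hΨ.continuousAt (hKsub hz.1).2).continuousWithinAt
  have hpF : Ψ p ∉ Ψ '' F := by
    rintro ⟨z, hz, hzp⟩
    refine (hKsub hz.1).1.2 (fun h ↦ hz.2 ?_) hzp
    rw [mem_singleton_iff] at h
    rwa [h]
  obtain ⟨ρ, hρ, -, hρF⟩ := exists_sphericalDisk_subset (hΨF.isClosed.isOpen_compl.mem_nhds hpF)
  refine ⟨ρ, hρ, ?_⟩
  have hpD : p ∈ diskPreimage e Ψ (Ψ p) ρ := ⟨hp, center_mem_sphericalDisk _ hρ⟩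
  refine (isPreconnected_connectedComponentIn.subset_left_of_subset_union isOpen_interior
    hK.isClosed.isOpen_compl ?_ ?_ ⟨p, mem_connectedComponentIn hpD, hpK⟩).trans ?_
  · exact disjoint_left.2 fun z h1 h2 ↦ h2 (interior_subset h1)
  · intro z hz
    by_contra hcon
    rw [mem_union, not_or, mem_compl_iff, not_not] at hcon
    exact hρF (connectedComponentIn_subset _ _ hz).2 ⟨z, ⟨hcon.2, hcon.1⟩, rfl⟩
  · exact fun z hz ↦ (hKsub (interior_subset hz)).1.1

lemma exists_nhd_subset (U : InverseGerm e Ψ) (hp : ∀ ρ, p ∈ U.nhd ρ) {N : Set S}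
    (hN : N ∈ 𝓝 p) : ∃ ρ, U.nhd ρ ⊆ N := by
  have hpe : p ≠ e := (U.nhd_subset ⟨1, mem_Ioi.2 one_pos⟩ (hp _)).1
  obtain ⟨ρ, hρ, h⟩ := hΨ.exists_connectedComponentIn_subset hpe hN
  refine ⟨⟨ρ, hρ⟩, ?_⟩
  rwa [U.nhd_eq_of_mem (hp _), ← U.eq_base_of_mem_iInter hp]

/-- The neighbourhoods become arbitrarily small around a common point. To show that a germ is not
transcendental it therefore suffices to find one common point, and that point determines the whole
intersection. -/
lemma iInter_nhd_eq_singleton (U : InverseGerm e Ψ) (hp : ∀ ρ, p ∈ U.nhd ρ) :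
    ⋂ ρ, U.nhd ρ = {p} := by
  refine Subset.antisymm (fun q hq ↦ ?_) (by simpa using hp)
  rw [mem_iInter] at hq
  by_contra hqp
  obtain ⟨ρ, hρ⟩ := hΨ.exists_nhd_subset U hp (isOpen_ne.mem_nhds (Ne.symm hqp))
  exact hρ (hq ρ) rfl

/-- An algebraic singularity is separate. -/
theorem isSeparate_of_isAlgebraic {U : InverseGerm e Ψ} (hU : U.IsAlgebraic) : U.IsSeparate := by
  have := ChartedSpace.locallyCompactSpace ℂ S
  obtain ⟨z₀, hz₀, -⟩ := hU
  have hmem : ∀ ρ, z₀ ∈ U.nhd ρ := by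
    rw [← mem_iInter, hz₀]; rfl
  have hz₀e : z₀ ≠ e := (U.nhd_subset ⟨1, mem_Ioi.2 one_pos⟩ (hmem _)).1
  have h1 := eventually_nhdsWithin_iff.1
    ((hΨ.meromorphic z₀ hz₀e).eventually_injOn (hΨ.not_eventually_eq hz₀e))
  obtain ⟨K, hKn, hKsub, hK⟩ := local_compact_nhds
    (inter_mem h1 (isOpen_ne.mem_nhds hz₀e))
  obtain ⟨ρ₁, hρ₁⟩ := hΨ.exists_nhd_subset U hmem hKn
  refine ⟨ρ₁, fun V hV hVU ↦ ?_⟩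
  by_contra! hmeet
  obtain ⟨x, hxK, hx⟩ := hΨ.exists_mem_of_isCompact V hK (fun he ↦ (hKsub he).2 rfl) fun ρ ↦ by
    obtain ⟨y, hyU, hyV⟩ := not_disjoint_iff.1 (hmeet ρ)
    exact ⟨y, hyV, hρ₁ hyU⟩
  have hVx := hΨ.iInter_nhd_eq_singleton V hx
  rcases hV with ⟨z₁, hz₁, hcrit⟩ | hV
  · have hxz : x = z₁ := singleton_injective (hVx.symm.trans hz₁)
    subst hxz
    have hxz₀ : x = z₀ := by
      by_contra hne
      exact hcrit.not_injOn ((hKsub hxK).1 hne)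
    subst hxz₀
    refine hVU (InverseGerm.eq_of_forall_inter_nonempty ?_ fun ρ ↦ ⟨x, hx ρ, hmem ρ⟩)
    rw [← V.eq_base_of_mem_iInter hx, U.eq_base_of_mem_iInter hmem]
  · rw [InverseGerm.IsTranscendental, hVx] at hV
    exact singleton_ne_empty _ hV

end IsTranscendentalMeromorphic

end Surface

/-! ### The exponential covering of a punctured disk -/

/-- The exponential map in the coordinate centred at `a`, a universal covering of the sphere
punctured at `a` and at its antipode. -/
def expPt (a : OnePoint ℂ) (s : ℂ) : OnePoint ℂ := centeredPt a (Complex.exp s)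

lemma continuous_expPt (a : OnePoint ℂ) : Continuous (expPt a) :=
  (continuous_centeredPt a).comp Complex.continuous_exp

lemma mem_range_expPt {a t : OnePoint ℂ} :
    t ∈ range (expPt a) ↔ t ∈ range (centeredPt a) ∧ t ≠ a := by
  constructor
  · rintro ⟨s, rfl⟩
    refine ⟨⟨_, rfl⟩, fun h ↦ Complex.exp_ne_zero s (centeredPt_injective a ?_)⟩
    rw [centeredPt_zero]
    exact h
  · rintro ⟨⟨w, rfl⟩, hne⟩
    have hw : w ≠ 0 := by rintro rfl; simp at hne
    exact ⟨Complex.log w, by rw [expPt, Complex.exp_log hw]⟩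

lemma expPt_ne (a : OnePoint ℂ) (s : ℂ) : expPt a s ≠ a := (mem_range_expPt.1 ⟨s, rfl⟩).2

lemma sphericalDist_expPt (a : OnePoint ℂ) (s : ℂ) :
    sphericalDist (expPt a s) a = 2 * Real.arctan (Real.exp s.re) := by
  rw [expPt, sphericalDist_centeredPt, Complex.norm_exp]

lemma expPt_eq_expPt_iff {a : OnePoint ℂ} {s s' : ℂ} :
    expPt a s = expPt a s' ↔ ∃ n : ℤ, s = s' + n * (2 * Real.pi * Complex.I) := by
  rw [← Complex.exp_eq_exp_iff_exists_int]
  exact (centeredPt_injective a).eq_iff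

lemma finite_compl_range_expPt (a : OnePoint ℂ) : (range (expPt a))ᶜ.Finite := by
  refine (toFinite {a, homogPt (centerFst a) (-conj (centerSnd a))}).subset fun t ht ↦ ?_
  by_cases h : t ∈ range (centeredPt a)
  · left
    by_contra hne
    exact ht (mem_range_expPt.2 ⟨h, hne⟩)
  · right
    exact eq_of_notMem_range_centeredPt h

/-- Small punctured disks around any point of the sphere, without the two points missed by the
exponential map, are path connected. -/
lemma exists_isPathConnected_sphericalDisk (a : OnePoint ℂ) {b : OnePoint ℂ}
    {N : Set (OnePoint ℂ)} (hN : N ∈ 𝓝 b) :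
    ∃ r, 0 < r ∧ sphericalDisk b r ⊆ N ∧
      IsPathConnected (sphericalDisk b r ∩ range (expPt a)) := by
  -- The disk is chosen to avoid the points missed by the exponential, except possibly its centre
  -- `b`. What remains is a full disk or a disk punctured at its centre.
  have hfin : ((range (expPt a))ᶜ \ {b}).Finite := (finite_compl_range_expPt a).sdiff
  obtain ⟨r, hr, hr', hrN⟩ := exists_sphericalDisk_subset
    (inter_mem hN (hfin.isClosed.isOpen_compl.mem_nhds (fun h ↦ h.2 rfl)))
  refine ⟨r, hr, hrN.trans inter_subset_left, ?_⟩
  have hR := tan_half_pos hr hr'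
  have hc := (continuous_centeredPt b)
  by_cases hb : b ∈ range (expPt a)
  · have : sphericalDisk b r ∩ range (expPt a) =
        centeredPt b '' Metric.ball 0 (Real.tan (r / 2)) := by
      rw [← sphericalDisk_eq_image hr hr', inter_eq_left]
      intro t ht
      by_contra hta
      exact (hrN ht).2 ⟨hta, fun h ↦ hta (by rwa [mem_singleton_iff.1 h])⟩
    rw [this]
    exact (Metric.isPathConnected_ball hR).image hc
  · have : sphericalDisk b r ∩ range (expPt a) =
        centeredPt b '' (Metric.ball 0 (Real.tan (r / 2)) \ {0}) := by
      rw [image_sdiff (centeredPt_injective b), ← sphericalDisk_eq_image hr hr', image_singleton,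
        centeredPt_zero]
      ext t
      constructor
      · rintro ⟨h1, h2⟩
        refine ⟨h1, fun h ↦ hb ?_⟩
        rwa [← mem_singleton_iff.1 h]
      · rintro ⟨h1, h2⟩
        refine ⟨h1, ?_⟩
        by_contra hta
        exact (hrN h1).2 ⟨hta, h2⟩
    rw [this]
    exact (isPathConnected_ball_diff_singleton _ hR).image hc

/-- Paths lift through the exponential map. -/
lemma exists_path_lift_expPt {a : OnePoint ℂ} (γ : C(I, OnePoint ℂ))
    (hγ : ∀ t, γ t ∈ range (expPt a)) {s : ℂ} (hs : expPt a s = γ 0) :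
    ∃ Γ : C(I, ℂ), Γ 0 = s ∧ ∀ t, expPt a (Γ t) = γ t := by
  set h := (isOpenEmbedding_centeredPt a).isEmbedding.toHomeomorph
  have hh : ∀ t : range (centeredPt a), centeredPt a (h.symm t) = t := fun t ↦
    congrArg Subtype.val (h.apply_symm_apply t)
  have hmem : ∀ t, γ t ∈ range (centeredPt a) := fun t ↦ (mem_range_expPt.1 (hγ t)).1
  have hcont : Continuous fun t ↦ h.symm ⟨γ t, hmem t⟩ :=
    h.symm.continuous.comp (γ.continuous.subtype_mk hmem)
  have hne : ∀ t, h.symm ⟨γ t, hmem t⟩ ≠ 0 := by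
    intro t ht
    have h1 := hh ⟨γ t, hmem t⟩
    rw [ht, centeredPt_zero] at h1
    exact (mem_range_expPt.1 (hγ t)).2 h1.symm
  obtain ⟨Γ, hΓ, hΓ0⟩ := Complex.isCoveringMap_exp.exists_path_lifts
    ⟨fun t ↦ ⟨h.symm ⟨γ t, hmem t⟩, hne t⟩, hcont.subtype_mk hne⟩ s (by
      refine Subtype.ext (centeredPt_injective a ?_)
      change centeredPt a (h.symm ⟨γ 0, hmem 0⟩) = expPt a s
      rw [hh, hs])
  refine ⟨Γ, hΓ0, fun t ↦ ?_⟩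
  have h1 : Complex.exp (Γ t) = h.symm ⟨γ t, hmem t⟩ := congrArg Subtype.val (congrFun hΓ t)
  rw [expPt, h1, hh]

lemma isLocalHomeomorph_expPt (a : OnePoint ℂ) : IsLocalHomeomorph (expPt a) := by
  refine (isOpenEmbedding_centeredPt a).isLocalHomeomorph.comp ?_
  rw [isLocalHomeomorph_iff_isLocalHomeomorphOn_univ]
  refine Complex.isCoveringMapOn_exp.isLocalHomeomorphOn.mono fun s _ ↦ ?_
  exact Complex.exp_ne_zero s

/-- The half-plane that the exponential map, in any centred coordinate, maps to the punctured disk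
of radius `ρ`; the whole plane if `π ≤ ρ`. -/
def expHalfPlane (ρ : ℝ) : Set ℂ := {s | 2 * Real.arctan (Real.exp s.re) < ρ}

lemma expPt_mem_sphericalDisk {a : OnePoint ℂ} {s : ℂ} {ρ : ℝ} :
    expPt a s ∈ sphericalDisk a ρ ↔ s ∈ expHalfPlane ρ := by
  rw [sphericalDisk, mem_ofPred_eq, sphericalDist_expPt]
  rfl

lemma expHalfPlane_of_re_le {ρ : ℝ} {s s' : ℂ} (hs : s ∈ expHalfPlane ρ) (h : s'.re ≤ s.re) :
    s' ∈ expHalfPlane ρ := by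
  have h1 : 2 * Real.arctan (Real.exp s.re) < ρ := hs
  have h2 := Real.arctan_strictMono.monotone (Real.exp_le_exp.2 h)
  change 2 * Real.arctan (Real.exp s'.re) < ρ
  linarith

lemma expHalfPlane_mono {ρ₁ ρ₂ : ℝ} (h : ρ₁ ≤ ρ₂) : expHalfPlane ρ₁ ⊆ expHalfPlane ρ₂ :=
  fun _ hs ↦ lt_of_lt_of_le hs h

lemma convex_expHalfPlane (ρ : ℝ) : Convex ℝ (expHalfPlane ρ) := by
  intro x hx y hy α β hα hβ hαβ
  have key : (α • x + β • y).re ≤ max x.re y.re := by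
    simp only [Complex.add_re, Complex.real_smul, Complex.re_ofReal_mul]
    calc α * x.re + β * y.re ≤ α * max x.re y.re + β * max x.re y.re := by
          gcongr
          · exact le_max_left _ _
          · exact le_max_right _ _
      _ = max x.re y.re := by rw [← add_mul, hαβ, one_mul]
  rcases le_total x.re y.re with h | h
  · exact expHalfPlane_of_re_le hy (by rwa [max_eq_right h] at key)
  · exact expHalfPlane_of_re_le hx (by rwa [max_eq_left h] at key)

lemma isOpen_expHalfPlane (ρ : ℝ) : IsOpen (expHalfPlane ρ) := by
  refine isOpen_lt ?_ continuous_const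
  exact continuous_const.mul
    (Real.continuous_arctan.comp (Real.continuous_exp.comp Complex.continuous_re))

lemma nonempty_expHalfPlane {ρ : ℝ} (hρ : 0 < ρ) : (expHalfPlane ρ).Nonempty := by
  -- Any centre would do here, since the half-plane depends on the radius only.
  obtain ⟨r, hr, hrN, hc⟩ := exists_isPathConnected_sphericalDisk OnePoint.infty
    (sphericalDisk_mem_nhds OnePoint.infty hρ)
  obtain ⟨_, ⟨h1, s, rfl⟩⟩ := hc.nonempty
  exact ⟨s, expPt_mem_sphericalDisk.1 (hrN h1)⟩

/-! ### Lifting the exponential covering -/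

section Lift

variable {Y : Type*} [TopologicalSpace Y] [T2Space Y] {q : Y → OnePoint ℂ} {a : OnePoint ℂ} {ρ : ℝ}

/-- Paths in the disk of radius `ρ` around `a`, punctured at `a` and at the antipode of `a`, lift
through `q`. -/
def HasPathLifts (q : Y → OnePoint ℂ) (a : OnePoint ℂ) (ρ : ℝ) : Prop :=
  ∀ γ : C(I, OnePoint ℂ), (∀ t, γ t ∈ sphericalDisk a ρ ∩ range (expPt a)) →
    ∀ y : Y, q y = γ 0 → ∃ Γ : C(I, Y), Γ 0 = y ∧ ∀ t, q (Γ t) = γ t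

/-- The half-plane is convex: lift the images of the segments issuing from `s₀` and take endpoints.
Lifts through a local homeomorphism depend continuously on the parameter. -/
lemma HasPathLifts.exists_expPt_lift (hq : IsLocalHomeomorph q) (hpl : HasPathLifts q a ρ)
    {y₀ : Y} (s₀ : expHalfPlane ρ) (h₀ : q y₀ = expPt a s₀) :
    ∃ F : C(expHalfPlane ρ, Y), F s₀ = y₀ ∧ ∀ s, q (F s) = expPt a s := by
  set ℓ : I × expHalfPlane ρ → ℂ := fun x ↦ (s₀ : ℂ) + (x.1 : ℝ) • ((x.2 : ℂ) - s₀) with hℓ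
  have hℓmem : ∀ x, ℓ x ∈ expHalfPlane ρ := fun x ↦
    (convex_expHalfPlane ρ).add_smul_sub_mem s₀.2 x.2.2 x.1.2
  have hℓc : Continuous ℓ := by fun_prop
  have hlift : ∀ s : expHalfPlane ρ, ∃ Γ : C(I, Y), Γ 0 = y₀ ∧
      ∀ t, q (Γ t) = expPt a (ℓ (t, s)) := by
    intro s
    refine hpl ⟨fun t ↦ expPt a (ℓ (t, s)), (continuous_expPt a).comp (by fun_prop)⟩ ?_ y₀ ?_
    · exact fun t ↦ ⟨expPt_mem_sphericalDisk.2 (hℓmem _), ⟨_, rfl⟩⟩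
    · simp [hℓ, h₀]
  choose Γ hΓ0 hΓ using hlift
  have hcont := hq.continuous_lift (T2Space.isSeparatedMap q)
    ⟨fun x ↦ expPt a (ℓ x), (continuous_expPt a).comp hℓc⟩ (g := fun x ↦ Γ x.2 x.1)
    (funext fun x ↦ hΓ x.2 x.1) (by simp only [hΓ0]; exact continuous_const)
    (fun s ↦ (Γ s).continuous)
  refine ⟨⟨fun s ↦ Γ s 1, hcont.comp (by fun_prop : Continuous fun s ↦ ((1 : I), s))⟩, ?_, ?_⟩
  · have hconst : (Γ s₀ : I → Y) = fun _ ↦ y₀ := by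
      refine (T2Space.isSeparatedMap q).eq_of_comp_eq hq.isLocallyInjective (Γ s₀).continuous
        continuous_const (funext fun t ↦ ?_) 0 (hΓ0 s₀)
      simp [hΓ, hℓ, h₀]
    exact congrFun hconst 1
  · intro s
    simp [hΓ, hℓ]

variable {F : C(expHalfPlane ρ, Y)}

/-- Take a sheet around `y` over a small disk. It contains some `F s`. Any other point `z` of the
sheet is reached by joining the images of `F s` and `z` in the disk, lifting that path to the
half-plane from `s` and applying `F`; uniqueness of lifts makes the result end at `z`. -/
lemma exists_nhds_subset_range_lift (hq : IsLocalHomeomorph q)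
    (hF : ∀ s, q (F s) = expPt a s) {y : Y} (hyD : q y ∈ sphericalDisk a ρ)
    (hy : y ∈ closure (range F)) :
    ∃ N ∈ 𝓝 y, ∀ z ∈ N, q z ∈ range (expPt a) → z ∈ range F := by
  obtain ⟨φ, hyφ, rfl⟩ := hq y
  obtain ⟨r, hr, hrN, hc⟩ := exists_isPathConnected_sphericalDisk a
    (inter_mem (φ.open_target.mem_nhds (φ.map_source hyφ))
      ((isOpen_sphericalDisk a ρ).mem_nhds hyD))
  have hN : φ.source ∩ φ ⁻¹' sphericalDisk (φ y) r ∈ 𝓝 y :=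
    inter_mem (φ.open_source.mem_nhds hyφ)
      ((φ.continuousAt hyφ).preimage_mem_nhds (sphericalDisk_mem_nhds _ hr))
  refine ⟨_, hN, fun z hz hzE ↦ ?_⟩
  obtain ⟨_, hs, s, rfl⟩ := mem_closure_iff_nhds.1 hy _ hN
  obtain ⟨γ, hγ⟩ := hc.joinedIn (φ (F s)) ⟨hs.2, s, (hF s).symm⟩ (φ z) ⟨hz.2, hzE⟩
  obtain ⟨Γ, hΓ0, hΓ⟩ := exists_path_lift_expPt (a := a) (s := s) γ.toContinuousMap
    (fun t ↦ (hγ t).2) (by simp [hF])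
  have hΓmem : ∀ t, Γ t ∈ expHalfPlane ρ := by
    intro t
    rw [← expPt_mem_sphericalDisk (a := a), hΓ]
    exact (hrN (hγ t).1).2
  have key : (fun t ↦ F ⟨Γ t, hΓmem t⟩) = fun t ↦ φ.symm (γ t) := by
    refine (T2Space.isSeparatedMap φ).eq_of_comp_eq hq.isLocallyInjective
      (F.continuous.comp (Γ.continuous.subtype_mk hΓmem))
      (φ.continuousOn_symm.comp_continuous γ.continuous fun t ↦ (hrN (hγ t).1).1)
      (funext fun t ↦ ?_) 0 ?_
    · simp only [Function.comp_apply, hF, hΓ]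
      rw [φ.right_inv (hrN (hγ t).1).1]
      rfl
    · simp only [hΓ0, γ.source]
      rw [φ.left_inv hs.1]
  have h1 := congrFun key 1
  simp only [γ.target, φ.left_inv hz.1] at h1
  exact ⟨_, h1⟩

variable [PreconnectedSpace Y]

/-- The closure of the range is open as well, because `q` is open and the points missed by the
exponential have dense complement; connectedness does the rest. -/
lemma denseRange_lift (hq : IsLocalHomeomorph q) (hρ : 0 < ρ)
    (hqD : ∀ y, q y ∈ sphericalDisk a ρ) (hF : ∀ s, q (F s) = expPt a s) : DenseRange F := by
  have hcl : IsClopen (closure (range F)) := by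
    refine ⟨isClosed_closure, isOpen_iff_mem_nhds.2 fun y hy ↦ ?_⟩
    obtain ⟨N, hN, hNF⟩ := exists_nhds_subset_range_lift hq hF (hqD y) hy
    refine mem_of_superset (interior_mem_nhds.2 hN) fun z hz ↦ ?_
    rw [mem_closure_iff_nhds]
    intro M hM
    have hMN := inter_mem hM (isOpen_interior.mem_nhds hz)
    obtain ⟨r, hr, hrN, hc⟩ := exists_isPathConnected_sphericalDisk a
      (hq.isOpenMap.image_mem_nhds hMN)
    obtain ⟨t, ht, htE⟩ := hc.nonempty
    obtain ⟨x, ⟨hxM, hxN⟩, rfl⟩ := hrN ht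
    exact ⟨x, hxM, hNF x (interior_subset hxN) htE⟩
  obtain ⟨s, hs⟩ := nonempty_expHalfPlane hρ
  rw [DenseRange, dense_iff_closure_eq]
  exact hcl.eq_univ ⟨F ⟨s, hs⟩, subset_closure ⟨_, rfl⟩⟩

/-- The lift of the exponential covering takes all values, apart from points over `a` and over its
antipode. -/
lemma mem_range_lift (hq : IsLocalHomeomorph q) (hρ : 0 < ρ)
    (hqD : ∀ y, q y ∈ sphericalDisk a ρ) (hF : ∀ s, q (F s) = expPt a s) {y : Y}
    (hy : q y ∈ range (expPt a)) : y ∈ range F := by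
  obtain ⟨N, hN, hNF⟩ := exists_nhds_subset_range_lift hq hF (hqD y)
    (denseRange_lift hq hρ hqD hF y)
  exact hNF y (mem_of_mem_nhds hN) hy

end Lift

/-! ### Continuation of lifts of paths -/

section PathLift

variable {Y Z : Type*} [TopologicalSpace Y] [T2Space Y] [TopologicalSpace Z] [T2Space Z]
  {q : Y → Z}

/-- A path lifts through a local homeomorphism if every lift of an initial part of it has a limit
at its endpoint. -/
lemma IsLocalHomeomorph.exists_path_lift_of_tendsto (hq : IsLocalHomeomorph q) (γ : C(I, Z))
    {y : Y} (hy : q y = γ 0)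
    (hlim : ∀ (τ : I) (f : I → Y), 0 < τ → ContinuousOn f (Iio τ) →
      (∀ t < τ, q (f t) = γ t) → ∃ p : Y, Tendsto f (𝓝[<] τ) (𝓝 p)) :
    ∃ Γ : C(I, Y), Γ 0 = y ∧ ∀ t, q (Γ t) = γ t := by
  -- The times up to which a lift exists form a clopen set: a local inverse extends a lift past its
  -- endpoint, and the assumed limit closes it up.
  set A : Set I := {τ | ∃ f : I → Y, ContinuousOn f (Iic τ) ∧ f 0 = y ∧ ∀ t ≤ τ, q (f t) = γ t}
  have h0 : (0 : I) ∈ A := by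
    refine ⟨fun _ ↦ y, continuousOn_const, rfl, fun t ht ↦ ?_⟩
    rw [le_antisymm ht bot_le, hy]
  have hlower : ∀ {t τ : I}, t ≤ τ → τ ∈ A → t ∈ A := by
    rintro t τ ht ⟨f, hf, hf0, hfq⟩
    exact ⟨f, hf.mono (Iic_subset_Iic.2 ht), hf0, fun s hs ↦ hfq s (hs.trans ht)⟩
  have hAo : IsOpen A := by
    rw [isOpen_iff_mem_nhds]
    rintro τ ⟨f, hf, hf0, hfq⟩
    obtain ⟨φ, hφ, hφq⟩ := hq (f τ)
    have hτ : γ τ ∈ φ.target := by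
      rw [← hfq τ le_rfl, hφq]
      exact φ.map_source hφ
    obtain ⟨b, hb, hbn, hbt⟩ := exists_Icc_mem_subset_of_mem_nhdsGE
      (nhdsWithin_le_nhds ((φ.open_target.preimage γ.continuous).mem_nhds hτ))
    have hbA : b ∈ A := by
      refine ⟨fun t ↦ if t ≤ τ then f t else φ.symm (γ t),
        .if (fun s hs ↦ ?_) (hf.mono fun s hs ↦ ?_) ?_, ?_, fun t ht ↦ ?_⟩
      · have hsτ : s = τ := frontier_Iic_subset _ hs.2
        subst hsτ
        rw [← hfq s le_rfl, hφq, φ.left_inv hφ]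
      · rw [closure_le_eq continuous_id' continuous_const] at hs
        exact hs.2
      · refine φ.continuousOn_symm.comp γ.continuous.continuousOn fun s hs ↦ ?_
        simp_rw [not_le] at hs
        exact hbt ⟨closure_lt_subset_le (f := fun _ : I ↦ τ) continuous_const continuous_id hs.2, hs.1⟩
      · simp only [hf0]
        exact if_pos bot_le
      · dsimp only
        split_ifs with h
        · exact hfq t h
        · rw [hφq, φ.right_inv (hbt ⟨(not_le.1 h).le, ht⟩)]
    have hIic : Iic b ∈ 𝓝 τ := by
      rw [← nhdsLE_sup_nhdsGE, mem_sup]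
      refine ⟨mem_of_superset self_mem_nhdsWithin fun t ht ↦ le_trans ht hb, ?_⟩
      exact mem_of_superset hbn Icc_subset_Iic_self
    exact mem_of_superset hIic fun t ht ↦ hlower ht hbA
  have hAc : IsClosed A := by
    refine isClosed_of_closure_subset fun τ hτ ↦ ?_
    by_contra hτA
    have hlt : ∀ t < τ, t ∈ A := by
      intro t ht
      obtain ⟨s, hts, hs⟩ := mem_closure_iff_nhds.1 hτ _ (Ioi_mem_nhds ht)
      exact hlower (le_of_lt hts) hs
    have hτ0 : 0 < τ := by
      rcases (bot_le : (0 : I) ≤ τ).eq_or_lt with h | h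
      · exact absurd (h ▸ h0) hτA
      · exact h
    have : Nonempty Y := ⟨y⟩
    choose! f hf hf0 hfq using hlt
    -- The chosen partial lifts agree by uniqueness, so the diagonal `t ↦ f t t` is a lift on all of
    -- `Iio τ`.
    have hglue : ∀ t < τ, ∀ s ≤ t, f s s = f t s := by
      intro t ht s hs
      have hs' := hs.trans_lt ht
      refine (T2Space.isSeparatedMap q).eqOn_of_comp_eqOn hq.isLocallyInjective
        (isPreconnected_Iic (a := s)) (hf s hs') ((hf t ht).mono (Iic_subset_Iic.2 hs))
        (fun u hu ↦ ?_) (a := 0) (mem_Iic.2 bot_le) ?_ (mem_Iic.2 le_rfl)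
      · have hu : u ≤ s := hu
        simp [hfq s hs' u hu, hfq t ht u (hu.trans hs)]
      · rw [hf0 s hs', hf0 t ht]
    have hcont : ∀ t < τ, ContinuousAt (fun t ↦ f t t) t := by
      intro t ht
      obtain ⟨u, htu, huτ⟩ := exists_between ht
      have h1 : ContinuousAt (f u) t := (hf u huτ).continuousAt (Iic_mem_nhds htu)
      refine h1.congr ?_
      filter_upwards [Iic_mem_nhds htu] with s hs using (hglue u huτ s hs).symm
    obtain ⟨p, hp⟩ := hlim τ (fun t ↦ f t t) hτ0
      (fun t ht ↦ (hcont t ht).continuousWithinAt) (fun t ht ↦ hfq t ht t le_rfl)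
    have : (𝓝[<] τ).NeBot := nhdsLT_neBot_of_exists_lt ⟨0, hτ0⟩
    have hqp : q p = γ τ := by
      refine tendsto_nhds_unique ((hq.continuous.tendsto p).comp hp)
        (((γ.continuous.tendsto τ).mono_left nhdsWithin_le_nhds).congr' ?_)
      filter_upwards [self_mem_nhdsWithin] with t ht using (hfq t ht t le_rfl).symm
    classical
    refine hτA ⟨Function.update (fun t ↦ f t t) τ p, fun t ht ↦ ?_, ?_, fun t ht ↦ ?_⟩
    · rcases (mem_Iic.1 ht).eq_or_lt with rfl | ht
      · rw [continuousWithinAt_update_same]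
        refine hp.mono_left (nhdsWithin_mono _ ?_)
        rintro s ⟨hs, hne⟩
        exact lt_of_le_of_ne hs hne
      · refine ContinuousAt.continuousWithinAt ((hcont t ht).congr ?_)
        filter_upwards [Iio_mem_nhds ht] with s hs
        rw [Function.update_of_ne (ne_of_lt hs)]
    · rw [Function.update_of_ne hτ0.ne, hf0 0 hτ0]
    · rcases ht.eq_or_lt with rfl | ht
      · rw [Function.update_self, hqp]
      · rw [Function.update_of_ne ht.ne, hfq t ht t le_rfl]
  have hA : A = univ := IsClopen.eq_univ ⟨hAc, hAo⟩ ⟨0, h0⟩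
  obtain ⟨f, hf, hf0, hfq⟩ : (1 : I) ∈ A := hA ▸ mem_univ _
  refine ⟨⟨f, continuousOn_univ.1 (hf.mono fun t _ ↦ ?_)⟩, hf0, fun t ↦ hfq t ?_⟩
  · exact (le_top : t ≤ ⊤)
  · exact (le_top : t ≤ ⊤)

end PathLift

/-! ### Separateness gives lifts of paths -/

section Surface

variable {S : Type*} [TopologicalSpace S] [ChartedSpace ℂ S] [IsManifold 𝓘(ℂ) 1 S]
  [T2Space S] [ConnectedSpace S] {Ψ : S → OnePoint ℂ} {e : S}

namespace IsTranscendentalMeromorphic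

variable (hΨ : IsTranscendentalMeromorphic e Ψ)
include hΨ

/-- A nonconstant meromorphic function is open, so local injectivity is all that is missing. -/
lemma isLocalHomeomorph_restrict {X : Set S} (hX : IsOpen X) (heX : e ∉ X)
    (hinj : ∀ x ∈ X, ∃ N ∈ 𝓝 x, InjOn Ψ N) : IsLocalHomeomorph fun x : X ↦ Ψ x := by
  have hne : ∀ x : X, (x : S) ≠ e := fun x h ↦ heX (h ▸ x.2)
  have hcont : Continuous fun x : X ↦ Ψ x := continuous_iff_continuousAt.2 fun x ↦
    (hΨ.continuousAt (hne x)).comp continuous_subtype_val.continuousAt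
  have hopen : IsOpenMap fun x : X ↦ Ψ x := by
    rw [isOpenMap_iff_nhds_le]
    intro x N hN
    rw [mem_map] at hN
    have h1 := hX.isOpenEmbedding_subtypeVal.isOpenMap.image_mem_nhds hN
    refine mem_of_superset ((hΨ.meromorphic x (hne x)).image_mem_nhds
      (hΨ.not_eventually_eq (hne x)) h1) ?_
    rintro _ ⟨_, ⟨z, hz, rfl⟩, rfl⟩
    exact hz
  rw [isLocalHomeomorph_iff_isOpenEmbedding_restrict]
  intro x
  obtain ⟨N, hN, hNinj⟩ := hinj x x.2
  set M : Set X := interior (Subtype.val ⁻¹' N)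
  have hM : M ∈ 𝓝 x := interior_mem_nhds.2 (continuous_subtype_val.continuousAt.preimage_mem_nhds hN)
  refine ⟨M, hM, .of_continuous_injective_isOpenMap ?_ ?_ ?_⟩
  · exact hcont.comp continuous_subtype_val
  · rintro ⟨u, hu⟩ ⟨v, hv⟩ huv
    have hu' : u ∈ Subtype.val ⁻¹' N := interior_subset hu
    have hv' : v ∈ Subtype.val ⁻¹' N := interior_subset hv
    exact Subtype.ext (Subtype.ext (hNinj hu' hv' huv))
  · exact hopen.comp isOpen_interior.isOpenEmbedding_subtypeVal.isOpenMap

lemma exists_mem_ne {p : S} (hp : p ≠ e) {N : Set S} (hN : N ∈ 𝓝 p) (a : OnePoint ℂ) :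
    ∃ z ∈ N, Ψ z ≠ a := by
  by_cases h : Ψ p = a
  · have := nhdsNE_neBot_of_chartedSpace p
    have h1 := (hΨ.meromorphic p hp).eventually_ne (hΨ.not_eventually_eq hp)
    obtain ⟨z, hz1, hz2⟩ := (h1.and (nhdsWithin_le_nhds hN)).exists
    exact ⟨z, hz2, h ▸ hz1⟩
  · exact ⟨p, mem_of_mem_nhds hN, h⟩

variable {U : InverseGerm e Ψ}

/-- If `U (ρ)` is disjoint from a neighbourhood of every other singularity, paths in the punctured
disk lift to `U (ρ)`. -/
lemma hasPathLifts_of_separate {ρ : Ioi (0 : ℝ)}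
    (hq : IsLocalHomeomorph fun x : U.nhd ρ ↦ Ψ x)
    (hsep : ∀ V : InverseGerm e Ψ, V.IsSingularity → V ≠ U → ∃ ρ₂, Disjoint (U.nhd ρ) (V.nhd ρ₂)) :
    HasPathLifts (fun x : U.nhd ρ ↦ Ψ x) U.base ρ := by
  intro γ hγ y hy
  refine hq.exists_path_lift_of_tendsto γ hy fun τ f hτ hf hfγ ↦ ?_
  have hfe : ∀ t, (f t : S) ≠ e := fun t ↦ (U.nhd_subset ρ (f t).2).1
  have hstart : ∀ r : Ioi (0 : ℝ), ∃ t₀ < τ, ∀ t, t₀ ≤ t → t ≤ τ → γ t ∈ sphericalDisk (γ τ) r := by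
    intro r
    obtain ⟨t₀, ht₀, h⟩ := exists_Ioc_subset_of_mem_nhds
      ((γ.continuous.tendsto τ) (sphericalDisk_mem_nhds _ r.2)) ⟨0, hτ⟩
    obtain ⟨t₁, ht₀₁, ht₁⟩ := exists_between ht₀
    exact ⟨t₁, ht₁, fun t h1 h2 ↦ h ⟨ht₀₁.trans_le h1, h2⟩⟩
  choose t₀ ht₀ htγ using hstart
  have hsub : ∀ r : Ioi (0 : ℝ), (fun t ↦ (f t : S)) '' Ico (t₀ r) τ ⊆
      connectedComponentIn (diskPreimage e Ψ (γ τ) r) (f (t₀ r)) := by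
    intro r
    refine IsPreconnected.subset_connectedComponentIn ?_ ⟨t₀ r, ⟨le_rfl, ht₀ r⟩, rfl⟩ ?_
    · refine isPreconnected_Ico.image _ (continuous_subtype_val.comp_continuousOn (hf.mono ?_))
      exact fun t ht ↦ ht.2
    · rintro _ ⟨t, ht, rfl⟩
      refine ⟨hfe t, ?_⟩
      have h1 : Ψ (f t) = γ t := hfγ t ht.2
      rw [h1]
      exact htγ r t ht.1 ht.2.le
  -- The germ over `γ τ` followed by the partial lift: at radius `r`, the component containing the
  -- end piece of the lift. Monotonicity holds since two such end pieces share a point.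
  set V : InverseGerm e Ψ :=
    { base := γ τ
      nhd := fun r ↦ connectedComponentIn (diskPreimage e Ψ (γ τ) r) (f (t₀ r))
      isComponent := fun r ↦ by
        exact ⟨f (t₀ r), connectedComponentIn_subset _ _ (hsub r ⟨t₀ r, ⟨le_rfl, ht₀ r⟩, rfl⟩), rfl⟩
      mono := fun r₁ r₂ h ↦ by
        have ht : max (t₀ r₁) (t₀ r₂) < τ := max_lt (ht₀ r₁) (ht₀ r₂)
        have h1 := hsub r₁ ⟨_, ⟨le_max_left _ (t₀ r₂), ht⟩, rfl⟩
        have h2 := hsub r₂ ⟨_, ⟨le_max_right (t₀ r₁) _, ht⟩, rfl⟩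
        rw [connectedComponentIn_eq h1, connectedComponentIn_eq h2]
        exact connectedComponentIn_mono _ (diskPreimage_mono _ h.le) } with hV
  have hfV : ∀ r t, t₀ r ≤ t → t < τ → (f t : S) ∈ V.nhd r := fun r t h1 h2 ↦
    hsub r ⟨t, ⟨h1, h2⟩, rfl⟩
  have hVU : V ≠ U := by
    intro h
    have h1 : γ τ = U.base := congrArg InverseGerm.base h
    exact (mem_range_expPt.1 (hγ τ).2).2 h1
  -- Each `V.nhd r` contains points of the lift, which lie in `U.nhd ρ`; a transcendental `V` would
  -- contradict separateness. So `V` shrinks to a point `p`, the desired limit.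
  have hVt : ¬ V.IsTranscendental := by
    intro h
    obtain ⟨r, hr⟩ := hsep V (Or.inr h) hVU
    exact disjoint_left.1 hr (f (t₀ r)).2 (hfV r _ le_rfl (ht₀ r))
  obtain ⟨p, hp⟩ := nonempty_iff_ne_empty.2 hVt
  rw [mem_iInter] at hp
  have hpe : p ≠ e := (V.nhd_subset ρ (hp ρ)).1
  have hpU : p ∈ U.nhd ρ := by
    refine hΨ.mem_nhd_of_mem_closure U ?_ ⟨hpe, ?_⟩
    · rw [mem_closure_iff_nhds]
      intro N hN
      obtain ⟨r, hr⟩ := hΨ.exists_nhd_subset V hp hN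
      exact ⟨f (t₀ r), hr (hfV r _ le_rfl (ht₀ r)), (f (t₀ r)).2⟩
    · rw [V.eq_base_of_mem_iInter hp]
      exact (hγ τ).1
  refine ⟨⟨p, hpU⟩, tendsto_subtype_rng.2 fun N hN ↦ ?_⟩
  obtain ⟨r, hr⟩ := hΨ.exists_nhd_subset V hp hN
  rw [mem_map]
  filter_upwards [self_mem_nhdsWithin, nhdsWithin_le_nhds (Ici_mem_nhds (ht₀ r))] with t h1 h2
  exact hr (hfV r t h2 h1)

end IsTranscendentalMeromorphic

end Surface

/-! ### Covering property of the exponential and periodic lifts -/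

instance preconnectedSpace_expHalfPlane (ρ : ℝ) : PreconnectedSpace (expHalfPlane ρ) :=
  isPreconnected_iff_preconnectedSpace.1 (convex_expHalfPlane ρ).isPreconnected

lemma isCoveringMapOn_expPt (a : OnePoint ℂ) : IsCoveringMapOn (expPt a) (range (expPt a)) := by
  have hemb : IsOpenEmbedding fun z : {z : ℂ // z ≠ 0} ↦ centeredPt a z :=
    (isOpenEmbedding_centeredPt a).comp (IsOpen.isOpenEmbedding_subtypeVal isOpen_ne)
  have h1 := Complex.isCoveringMap_exp.homeomorph_comp hemb.isEmbedding.toHomeomorph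
  have hrange : range (fun z : {z : ℂ // z ≠ 0} ↦ centeredPt a z) = range (expPt a) := by
    ext t
    rw [mem_range_expPt]
    constructor
    · rintro ⟨z, rfl⟩
      refine ⟨⟨z, rfl⟩, fun h ↦ z.2 (centeredPt_injective a ?_)⟩
      rwa [centeredPt_zero]
    · rintro ⟨⟨w, rfl⟩, hne⟩
      exact ⟨⟨w, by rintro rfl; simp at hne⟩, rfl⟩
  rw [← hrange]
  exact IsCoveringMapOn.of_isCoveringMap_subtype hemb.isOpen_range (f := expPt a)
    (fun s ↦ ⟨⟨_, Complex.exp_ne_zero s⟩, rfl⟩) h1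

lemma sphericalDisk_diff_subset_range_expPt {a : OnePoint ℂ} {ρ : ℝ} (hρ : ρ ≤ Real.pi) :
    sphericalDisk a ρ \ {a} ⊆ range (expPt a) := fun _ ht ↦
  mem_range_expPt.2 ⟨sphericalDisk_subset_range hρ ht.1, ht.2⟩

lemma isPreconnected_sphericalDisk (a : OnePoint ℂ) {ρ : ℝ} (hρ : 0 < ρ) (hρ' : ρ < Real.pi) :
    IsPreconnected (sphericalDisk a ρ) := by
  rw [sphericalDisk_eq_image hρ hρ']
  exact Metric.isPreconnected_ball.image _ (continuous_centeredPt a).continuousOn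

section Lift

variable {Y : Type*} [TopologicalSpace Y] {q : Y → OnePoint ℂ} {a : OnePoint ℂ} {ρ : ℝ}
  {F : C(expHalfPlane ρ, Y)}

/-- A lift of the exponential covering that is not injective is periodic. -/
lemma exists_period_lift [T2Space Y] (hq : IsLocalHomeomorph q) (hF : ∀ s, q (F s) = expPt a s)
    (hinj : ¬ Function.Injective F) :
    ∃ c : ℝ, 0 < c ∧ ∀ s s' : expHalfPlane ρ, (s' : ℂ) = s + c * Complex.I → F s' = F s := by
  have key : ∀ s s' : expHalfPlane ρ, F s = F s' → ((s : ℂ)).im < (s' : ℂ).im →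
      ∃ c : ℝ, 0 < c ∧ ∀ s s' : expHalfPlane ρ, (s' : ℂ) = s + c * Complex.I → F s' = F s := by
    intro s s' hss hlt
    obtain ⟨n, hn⟩ := expPt_eq_expPt_iff.1 ((hF s').symm.trans ((congrArg q hss).symm.trans (hF s)))
    set c : ℝ := n * (2 * Real.pi) with hc
    have hn' : (s' : ℂ) = s + c * Complex.I := by rw [hn, hc]; push_cast; ring
    have hcpos : 0 < c := by
      have := congrArg Complex.im hn'
      simp at this
      linarith
    have hmem : ∀ z : expHalfPlane ρ, (z : ℂ) + c * Complex.I ∈ expHalfPlane ρ := fun z ↦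
      expHalfPlane_of_re_le z.2 (by simp)
    -- Translation by `c * I` preserves the half-plane and the exponential, so the translated `F`
    -- lifts the same map; agreement at `s` forces agreement everywhere.
    have heq : (fun z : expHalfPlane ρ ↦ F ⟨(z : ℂ) + c * Complex.I, hmem z⟩) = ⇑F := by
      refine (T2Space.isSeparatedMap q).eq_of_comp_eq hq.isLocallyInjective
        (F.continuous.comp (Continuous.subtype_mk (by fun_prop) hmem)) F.continuous
        (funext fun z ↦ ?_) s ?_
      · simp only [Function.comp_apply, hF]
        rw [expPt_eq_expPt_iff]
        exact ⟨n, by rw [hc]; push_cast; ring⟩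
      · rw [hss]
        exact congrArg F (Subtype.ext hn'.symm)
    refine ⟨c, hcpos, fun z z' hz ↦ ?_⟩
    rw [← congrFun heq z]
    exact congrArg F (Subtype.ext hz)
  simp only [Function.Injective, not_forall] at hinj
  obtain ⟨s, s', hss, hne⟩ := hinj
  rcases lt_trichotomy (s : ℂ).im (s' : ℂ).im with h | h | h
  · exact key s s' hss h
  · exfalso
    obtain ⟨n, hn⟩ := expPt_eq_expPt_iff.1 ((hF s).symm.trans ((congrArg q hss).trans (hF s')))
    refine hne (Subtype.ext (Complex.ext ?_ h))
    simpa using congrArg Complex.re hn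
  · exact key s' s hss.symm h

/-- The circle of radius `r` corresponds to a vertical line in the half-plane, and by periodicity
one segment of length `c` already covers its image. -/
lemma isCompact_preimage_sphere_of_periodic (hF : ∀ s, q (F s) = expPt a s)
    (hsurj : Function.Surjective F) {c : ℝ} (hc : 0 < c)
    (hper : ∀ s s' : expHalfPlane ρ, (s' : ℂ) = s + c * Complex.I → F s' = F s)
    {r : ℝ} (hr : 0 < r) (hrρ : r < ρ) (hrπ : r < Real.pi) :
    ∃ K : Set Y, IsCompact K ∧ ∀ y, sphericalDist (q y) a = r → y ∈ K := by
  set x : ℝ := Real.log (Real.tan (r / 2))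
  have hx : 2 * Real.arctan (Real.exp x) = r := by
    rw [Real.exp_log (tan_half_pos hr hrπ), Real.arctan_tan (by linarith) (by linarith)]
    ring
  have hmem : ∀ t : ℝ, (x : ℂ) + t * Complex.I ∈ expHalfPlane ρ := by
    intro t
    change 2 * Real.arctan (Real.exp ((x : ℂ) + t * Complex.I).re) < ρ
    simpa [hx] using hrρ
  set f : ℝ → Y := fun t ↦ F ⟨(x : ℂ) + t * Complex.I, hmem t⟩
  have hfc : Continuous f := F.continuous.comp (Continuous.subtype_mk (by fun_prop) hmem)
  have hfper : Function.Periodic f c := by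
    intro t
    refine hper _ _ ?_
    push_cast
    ring
  refine ⟨f '' Icc 0 c, isCompact_Icc.image hfc, fun y hy ↦ ?_⟩
  obtain ⟨s, rfl⟩ := hsurj y
  rw [hF, sphericalDist_expPt, ← hx] at hy
  have hre : (s : ℂ).re = x := by
    have h1 : Real.arctan (Real.exp (s : ℂ).re) = Real.arctan (Real.exp x) := by linarith
    exact Real.exp_injective (Real.arctan_injective h1)
  obtain ⟨t, ht, hft⟩ := hfper.exists_mem_Ico₀ hc (s : ℂ).im
  refine ⟨t, Ico_subset_Icc_self ht, ?_⟩
  rw [← hft]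
  refine congrArg F (Subtype.ext ?_)
  change (x : ℂ) + (s : ℂ).im * Complex.I = s
  rw [← hre]
  exact Complex.re_add_im _

end Lift

/-! ### Separate transcendental singularities are logarithmic -/

section Surface

variable {S : Type*} [TopologicalSpace S] [ChartedSpace ℂ S] [IsManifold 𝓘(ℂ) 1 S]
  [T2Space S] [ConnectedSpace S] {Ψ : S → OnePoint ℂ} {e : S}

namespace IsTranscendentalMeromorphic

variable (hΨ : IsTranscendentalMeromorphic e Ψ) {U : InverseGerm e Ψ} {ρ : Ioi (0 : ℝ)}
include hΨ

/-- A transcendental germ omits its base point on neighbourhoods to which the exponential covering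
lifts. -/
lemma ne_base_of_isTranscendental (hU : U.IsTranscendental)
    (hq : IsLocalHomeomorph fun x : U.nhd ρ ↦ Ψ x) (hρ : (ρ : ℝ) < Real.pi)
    {F : C(expHalfPlane ρ, U.nhd ρ)} (hF : ∀ s, Ψ (F s) = expPt U.base s) {x : S}
    (hx : x ∈ U.nhd ρ) : Ψ x ≠ U.base := by
  intro hxa
  have : PreconnectedSpace (U.nhd ρ) :=
    isPreconnected_iff_preconnectedSpace.1 (U.isPreconnected_nhd ρ)
  have hD : ∀ y : U.nhd ρ, Ψ y ∈ sphericalDisk U.base ρ := fun y ↦ (U.nhd_subset ρ y.2).2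
  have hdense := denseRange_lift hq ρ.2 hD hF
  obtain ⟨φ, hxφ, hφ⟩ := hq ⟨x, hx⟩
  have hφ' : ∀ y : U.nhd ρ, φ y = Ψ y := fun y ↦ (congrFun hφ y).symm
  have hat : U.base ∈ φ.target := by
    rw [← hxa, ← hφ' ⟨x, hx⟩]
    exact φ.map_source hxφ
  obtain ⟨r, hr, -, hrt⟩ := exists_sphericalDisk_subset (φ.open_target.mem_nhds hat)
  -- Over a small disk the sheet through `x` and the lift `F` agree off the centre. So the point `y`
  -- of `U.nhd δ` lies on that sheet, and connectedness of the sheet brings `x` into `U.nhd δ`.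
  have hall : ∀ ρ', x ∈ U.nhd ρ' := by
    intro ρ'
    set δ : Ioi (0 : ℝ) := min ρ' (min ⟨r, hr⟩ ρ)
    have hδρ : δ ≤ ρ := (min_le_right _ _).trans (min_le_right _ _)
    have hδr : (δ : ℝ) ≤ r := (min_le_right _ _).trans (min_le_left _ _)
    have hDt : sphericalDisk U.base δ ⊆ φ.target := (sphericalDisk_mono _ hδr).trans hrt
    refine U.nhd_mono (min_le_left _ _ : δ ≤ ρ') ?_
    obtain ⟨y₀, hy₀⟩ := U.nonempty_nhd δ
    obtain ⟨y, hy, hya⟩ := hΨ.exists_mem_ne (U.nhd_subset δ hy₀).1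
      ((hΨ.isOpen_nhd U δ).mem_nhds hy₀) U.base
    have hyD := (U.nhd_subset δ hy).2
    obtain ⟨s, hs⟩ := mem_range_lift hq ρ.2 hD hF (y := ⟨y, U.nhd_mono hδρ hy⟩)
      (sphericalDisk_diff_subset_range_expPt hρ.le ⟨hD _, hya⟩)
    have hsy : Ψ y = expPt U.base s := by rw [← hF, hs]
    have hsδ : (s : ℂ) ∈ expHalfPlane δ := by
      rwa [← expPt_mem_sphericalDisk (a := U.base), ← hsy]
    have hN : φ.source ∩ φ ⁻¹' sphericalDisk U.base δ ∈ 𝓝 ⟨x, hx⟩ := by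
      refine inter_mem (φ.open_source.mem_nhds hxφ)
        ((φ.continuousAt hxφ).preimage_mem_nhds ?_)
      rw [hφ', hxa]
      exact sphericalDisk_mem_nhds _ δ.2
    obtain ⟨_, ⟨hs'φ, hs'D⟩, s', rfl⟩ := mem_closure_iff_nhds.1 (hdense ⟨x, hx⟩) _ hN
    have hs'δ : (s' : ℂ) ∈ expHalfPlane δ := by
      rw [mem_preimage, hφ', hF] at hs'D
      exact expPt_mem_sphericalDisk.1 hs'D
    have hinc : ∀ z : expHalfPlane δ, (z : ℂ) ∈ expHalfPlane ρ := fun z ↦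
      expHalfPlane_mono hδρ z.2
    have hzD : ∀ z : expHalfPlane δ, expPt U.base z ∈ sphericalDisk U.base δ := fun z ↦
      expPt_mem_sphericalDisk.2 z.2
    have heq : (fun z : expHalfPlane δ ↦ F ⟨z, hinc z⟩) =
        fun z : expHalfPlane δ ↦ φ.symm (expPt U.base z) := by
      refine (T2Space.isSeparatedMap _).eq_of_comp_eq hq.isLocallyInjective
        (F.continuous.comp (continuous_subtype_val.subtype_mk hinc))
        (φ.continuousOn_symm.comp_continuous ((continuous_expPt _).comp continuous_subtype_val)
          fun z ↦ hDt (hzD z)) (funext fun z ↦ ?_) ⟨s', hs'δ⟩ ?_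
      · simp only [Function.comp_apply, hF]
        rw [← hφ', φ.right_inv (hDt (hzD z))]
      · change F s' = φ.symm (expPt U.base s')
        rw [← hF, ← hφ', φ.left_inv hs'φ]
    have hsym : F s = φ.symm (expPt U.base s) := congrFun heq ⟨s, hsδ⟩
    set T : Set S := (fun t ↦ (φ.symm t : S)) '' sphericalDisk U.base δ
    have hT : IsPreconnected T := (isPreconnected_sphericalDisk _ δ.2
      (lt_of_le_of_lt hδρ hρ)).image _
        (continuous_subtype_val.comp_continuousOn (φ.continuousOn_symm.mono hDt))
    have hTD : T ⊆ diskPreimage e Ψ U.base δ := by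
      rintro _ ⟨t, ht, rfl⟩
      refine ⟨(U.nhd_subset ρ (φ.symm t).2).1, ?_⟩
      rwa [← hφ', φ.right_inv (hDt ht)]
    have hyT : y ∈ T := ⟨Ψ y, hyD, by rw [hsy]; simp only; rw [← hsym, hs]⟩
    have hxT : x ∈ T := by
      refine ⟨U.base, center_mem_sphericalDisk _ δ.2, ?_⟩
      have h1 := φ.left_inv hxφ
      rw [hφ', hxa] at h1
      simp only [h1]
    exact U.subset_nhd hT hTD ⟨y, hyT, hy⟩ hxT
  have : x ∈ ⋂ ρ, U.nhd ρ := mem_iInter.2 hall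
  rw [InverseGerm.IsTranscendental] at hU
  rw [hU] at this
  exact this

omit [ConnectedSpace S] in
/-- At an essential singularity, the lift of the exponential covering is not periodic. -/
lemma injective_lift (hU : U.AccumulatesAtEssential)
    (hq : IsLocalHomeomorph fun x : U.nhd ρ ↦ Ψ x) (hρ : (ρ : ℝ) < Real.pi)
    {F : C(expHalfPlane ρ, U.nhd ρ)} (hF : ∀ s, Ψ (F s) = expPt U.base s)
    (hsurj : Function.Surjective F) : Function.Injective F := by
  by_contra hinj
  obtain ⟨c, hc, hper⟩ := exists_period_lift hq hF hinj
  have hρ0 : (0 : ℝ) < ρ := ρ.2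
  set r : ℝ := ρ / 2 with hrdef
  have hr : 0 < r := by positivity
  have hrρ : r < ρ := by linarith
  have hrπ : r < Real.pi := hrρ.trans hρ
  obtain ⟨K, hK, hKr⟩ := isCompact_preimage_sphere_of_periodic (q := fun x : U.nhd ρ ↦ Ψ x)
    hF hsurj hc hper hr hrρ hrπ
  have hK' : IsCompact (Subtype.val '' K) := hK.image continuous_subtype_val
  have heK : e ∉ Subtype.val '' K := by
    rintro ⟨x, -, hx⟩
    exact (U.nhd_subset ρ x.2).1 hx
  -- `W \ {e}` is connected and misses the part of `U.nhd ρ` over the circle of radius `r`. Every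
  -- boundary point of `U.nhd r` other than `e` lies in that part, so `W \ {e}`, which meets `U.nhd
  -- r`, is contained in it.
  obtain ⟨W, hWK, hWo, heW, hWc⟩ := exists_isPreconnected_diff_singleton
    (hK'.isClosed.isOpen_compl.mem_nhds heK)
  set Y := U.nhd ⟨r, hr⟩
  have hYU : Y ⊆ U.nhd ρ := U.nhd_mono hrρ.le
  have hYo : IsOpen Y := hΨ.isOpen_nhd U _
  have hsub : W \ {e} ⊆ Y := by
    refine hWc.subset_left_of_subset_union hYo (isClosed_closure (s := Y)).isOpen_compl ?_ ?_ ?_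
    · exact disjoint_left.2 fun x h1 h2 ↦ h2 (subset_closure h1)
    · rintro x ⟨hxW, hxe⟩
      by_contra hcon
      rw [mem_union, not_or, mem_compl_iff, not_not] at hcon
      obtain ⟨hxY, hxcl⟩ := hcon
      have hle : sphericalDist (Ψ x) U.base ≤ r := by
        have h1 := (hΨ.continuousAt hxe).continuousWithinAt.mem_closure_image hxcl
        refine closure_minimal ?_ (isClosed_sphericalDist_le U.base hr hrπ) h1
        rintro _ ⟨z, hz, rfl⟩
        have h2 : sphericalDist (Ψ z) U.base < r := (U.nhd_subset _ hz).2
        exact h2.le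
      rcases hle.eq_or_lt with h | h
      · have hxU : x ∈ U.nhd ρ := hΨ.mem_nhd_of_mem_closure U (closure_mono hYU hxcl)
          ⟨hxe, lt_of_le_of_lt hle hrρ⟩
        exact hWK hxW ⟨⟨x, hxU⟩, hKr ⟨x, hxU⟩ h, rfl⟩
      · exact hxY (hΨ.mem_nhd_of_mem_closure U hxcl ⟨hxe, h⟩)
    · obtain ⟨x, hxW, hxY⟩ := mem_closure_iff.1 (hU ⟨r, hr⟩) W hWo heW
      exact ⟨x, ⟨hxW, (U.nhd_subset _ hxY).1⟩, hxY⟩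
  refine hΨ.not_eventually_mem_sphericalDisk (a := U.base) hr hrπ ?_
  rw [eventually_nhdsWithin_iff]
  filter_upwards [hWo.mem_nhds heW] with z hz hze
  exact (U.nhd_subset _ (hsub ⟨hz, hze⟩)).2

lemma isLogarithmic_of_bijective_lift (hU : U.IsTranscendental)
    (hq : IsLocalHomeomorph fun x : U.nhd ρ ↦ Ψ x) (hρ : (ρ : ℝ) < Real.pi)
    {F : C(expHalfPlane ρ, U.nhd ρ)} (hF : ∀ s, Ψ (F s) = expPt U.base s)
    (hbij : Function.Bijective F) : U.IsLogarithmic := by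
  have hmaps : MapsTo Ψ (U.nhd ρ) (sphericalDisk U.base ρ \ {U.base}) := fun x hx ↦
    ⟨(U.nhd_subset ρ hx).2, hΨ.ne_base_of_isTranscendental hU hq hρ hF hx⟩
  have hloc : IsLocalHomeomorph F := by
    refine IsLocalHomeomorph.of_comp (g := fun x : U.nhd ρ ↦ Ψ x) ?_ hq F.continuous
    have : (fun x : U.nhd ρ ↦ Ψ x) ∘ F = expPt U.base ∘ Subtype.val := funext hF
    rw [this]
    exact (isLocalHomeomorph_expPt _).comp
      (isOpen_expHalfPlane ρ).isOpenEmbedding_subtypeVal.isLocalHomeomorph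
  set h : expHalfPlane ρ ≃ₜ U.nhd ρ := hloc.toHomeomorphOfBijective hbij
  refine ⟨hU, ρ, hmaps, ?_, ?_⟩
  · have hpre : expPt U.base ⁻¹' (sphericalDisk U.base ρ \ {U.base}) = expHalfPlane ρ := by
      ext s
      refine ⟨fun hs ↦ expPt_mem_sphericalDisk.1 hs.1, fun hs ↦ ⟨expPt_mem_sphericalDisk.2 hs, ?_⟩⟩
      exact expPt_ne _ _
    have hcov := ((isCoveringMapOn_expPt U.base).mono
      (sphericalDisk_diff_subset_range_expPt hρ.le)).isCoveringMap_restrictPreimage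
    have hcov' := (hcov.comp_homeomorph (Homeomorph.setCongr hpre.symm)).comp_homeomorph h.symm
    convert hcov' using 1
    funext x
    refine Subtype.ext ?_
    change Ψ x = expPt U.base (h.symm x)
    rw [← hF]
    exact congrArg (fun y : U.nhd ρ ↦ Ψ y) (h.apply_symm_apply x).symm
  · have : ContractibleSpace (expHalfPlane ρ) :=
      (convex_expHalfPlane ρ).contractibleSpace (nonempty_expHalfPlane ρ.2)
    have : ContractibleSpace (U.nhd ρ) := h.symm.contractibleSpace
    infer_instance

/-- A separate transcendental singularity at the essential singularity is logarithmic. -/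
theorem isLogarithmic_of_isSeparate (hU : U.IsTranscendental) (hacc : U.AccumulatesAtEssential)
    (hsep : U.IsSeparate) : U.IsLogarithmic := by
  obtain ⟨ρ₁, hρ₁⟩ := hsep
  -- The radius `1` serves only to stay below `π`, so that the disk misses the antipode of the base
  -- point.
  set ρ : Ioi (0 : ℝ) := min ρ₁ ⟨1, mem_Ioi.2 one_pos⟩
  have hρ : (ρ : ℝ) < Real.pi := by
    have h1 : (ρ : ℝ) ≤ 1 := min_le_right ρ₁ ⟨1, mem_Ioi.2 one_pos⟩
    linarith [Real.pi_gt_three]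
  have hsep : ∀ V : InverseGerm e Ψ, V.IsSingularity → V ≠ U →
      ∃ ρ₂, Disjoint (U.nhd ρ) (V.nhd ρ₂) := fun V hV hVU ↦
    (hρ₁ V hV hVU).imp fun _ h ↦ h.mono_left (U.nhd_mono (min_le_left _ _))
  have hne : ∀ x ∈ U.nhd ρ, x ≠ e := fun x hx ↦ (U.nhd_subset ρ hx).1
  have hcrit : ∀ x ∈ U.nhd ρ, ¬ IsCriticalPt Ψ x := by
    intro x hx hcx
    have hmem := InverseGerm.mem_ofPoint_nhd (Ψ := Ψ) (hne x hx)
    have hV := hΨ.iInter_nhd_eq_singleton _ hmem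
    obtain ⟨ρ₂, hdis⟩ := hsep (.ofPoint Ψ (hne x hx)) (Or.inl ⟨x, hV, hcx⟩) (by
      intro h
      rw [h] at hV
      exact singleton_ne_empty x (hV.symm.trans hU))
    exact disjoint_left.1 hdis hx (hmem ρ₂)
  have hq : IsLocalHomeomorph fun x : U.nhd ρ ↦ Ψ x :=
    hΨ.isLocalHomeomorph_restrict (hΨ.isOpen_nhd U ρ) (fun h ↦ hne e h rfl)
      fun x hx ↦ hΨ.injOn_of_not_isCriticalPt (hne x hx) (hcrit x hx)
  obtain ⟨z, hz⟩ := U.nonempty_nhd ρ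
  obtain ⟨y, hy, hya⟩ := hΨ.exists_mem_ne (hne z hz) ((hΨ.isOpen_nhd U ρ).mem_nhds hz) U.base
  have hD : ∀ x : U.nhd ρ, Ψ x ∈ sphericalDisk U.base ρ := fun x ↦ (U.nhd_subset ρ x.2).2
  obtain ⟨s, hs⟩ := sphericalDisk_diff_subset_range_expPt hρ.le ⟨hD ⟨y, hy⟩, hya⟩
  have hsH : s ∈ expHalfPlane ρ := by
    rw [← expPt_mem_sphericalDisk (a := U.base), hs]
    exact hD ⟨y, hy⟩
  obtain ⟨F, -, hF⟩ := (hΨ.hasPathLifts_of_separate hq hsep).exists_expPt_lift hq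
    (y₀ := ⟨y, hy⟩) ⟨s, hsH⟩ hs.symm
  have hsurj : Function.Surjective F := by
    have : PreconnectedSpace (U.nhd ρ) :=
      isPreconnected_iff_preconnectedSpace.1 (U.isPreconnected_nhd ρ)
    intro x
    exact mem_range_lift hq ρ.2 hD hF (sphericalDisk_diff_subset_range_expPt hρ.le
      ⟨hD x, hΨ.ne_base_of_isTranscendental hU hq hρ hF x.2⟩)
  exact hΨ.isLogarithmic_of_bijective_lift hU hq hρ hF
    ⟨hΨ.injective_lift hacc hq hρ hF hsurj, hsurj⟩

end IsTranscendentalMeromorphic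

end Surface

/-! ### Germs meeting a logarithmic singularity -/

namespace InverseGerm

variable {S : Type*} [TopologicalSpace S] {Ψ : S → OnePoint ℂ} {e : S} {U V : InverseGerm e Ψ}
  {ρ ρ₁ : Ioi (0 : ℝ)} (h : MapsTo Ψ (U.nhd ρ) (sphericalDisk U.base ρ \ {U.base}))
  (hcov : IsCoveringMap h.restrict)
include hcov

lemma isLocalHomeomorph_of_isCoveringMap :
    IsLocalHomeomorph fun x : U.nhd ρ ↦ Ψ x := by
  have hopen : IsOpen (sphericalDisk U.base ρ \ {U.base}) :=
    (isOpen_sphericalDisk _ _).sdiff isClosed_singleton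
  exact hopen.isOpenEmbedding_subtypeVal.isLocalHomeomorph.comp hcov.isLocalHomeomorph

lemma hasPathLifts_of_isCoveringMap :
    HasPathLifts (fun x : U.nhd ρ ↦ Ψ x) U.base ρ := by
  intro γ hγ y hy
  have hmem : ∀ t, γ t ∈ sphericalDisk U.base ρ \ {U.base} := fun t ↦
    ⟨(hγ t).1, (mem_range_expPt.1 (hγ t).2).2⟩
  obtain ⟨Γ, hΓ, hΓ0⟩ := hcov.exists_path_lifts
    ⟨fun t ↦ ⟨γ t, hmem t⟩, γ.continuous.subtype_mk hmem⟩ y (Subtype.ext hy.symm)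
  exact ⟨Γ, hΓ0, fun t ↦ congrArg Subtype.val (congrFun hΓ t)⟩

/-- A germ over the same point that meets all neighbourhoods of a logarithmic one is equal
to it. -/
lemma eq_of_isCoveringMap [T2Space S] (hb : V.base = U.base) (hρ₁ : ρ₁ ≤ ρ)
    (hρ₁π : (ρ₁ : ℝ) < Real.pi) (hmeet : ∀ ρ₂, ¬ Disjoint (U.nhd ρ₁) (V.nhd ρ₂)) : V = U := by
  have hq := isLocalHomeomorph_of_isCoveringMap h hcov
  have hD : ∀ y : U.nhd ρ, Ψ y ∈ sphericalDisk U.base ρ := fun y ↦ (h y.2).1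
  have : PreconnectedSpace (U.nhd ρ) :=
    isPreconnected_iff_preconnectedSpace.1 (U.isPreconnected_nhd ρ)
  have hrange : ∀ x ∈ U.nhd ρ, Ψ x ∈ sphericalDisk U.base ρ₁ → Ψ x ∈ range (expPt U.base) :=
    fun x hx hx₁ ↦ sphericalDisk_diff_subset_range_expPt hρ₁π.le ⟨hx₁, (h hx).2⟩
  obtain ⟨y, hy⟩ := U.nonempty_nhd ρ₁
  have hyU : y ∈ U.nhd ρ := U.nhd_mono hρ₁ hy
  obtain ⟨s, hs⟩ := hrange y hyU (U.nhd_subset _ hy).2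
  have hsH : s ∈ expHalfPlane ρ := by
    rw [← expPt_mem_sphericalDisk (a := U.base), hs]
    exact hD ⟨y, hyU⟩
  obtain ⟨F, -, hF⟩ := (hasPathLifts_of_isCoveringMap h hcov).exists_expPt_lift hq
    (y₀ := ⟨y, hyU⟩) ⟨s, hsH⟩ hs.symm
  refine eq_of_forall_inter_nonempty hb fun δ' ↦ ?_
  set δ := min δ' ρ₁
  have hδρ : δ ≤ ρ := (min_le_right _ _).trans hρ₁
  have hinc : ∀ z : expHalfPlane δ, (z : ℂ) ∈ expHalfPlane ρ := fun z ↦ expHalfPlane_mono hδρ z.2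
  -- The part of `U.nhd ρ` over the disk of radius `δ`. It is connected, being the image of a
  -- half-plane, hence contained in `U.nhd δ`; it also contains `V.nhd δ`.
  set Z : Set S := range fun z : expHalfPlane δ ↦ (F ⟨z, hinc z⟩ : S)
  have hZc : IsPreconnected Z := isPreconnected_range (continuous_subtype_val.comp
    (F.continuous.comp (continuous_subtype_val.subtype_mk hinc)))
  have hZD : Z ⊆ diskPreimage e Ψ U.base δ := by
    rintro _ ⟨z, rfl⟩
    refine ⟨(U.nhd_subset ρ (F _).2).1, ?_⟩
    rw [hF]
    exact expPt_mem_sphericalDisk.2 z.2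
  have hmemZ : ∀ x ∈ U.nhd ρ, x ∈ diskPreimage e Ψ U.base δ → x ∈ Z := by
    intro x hx hxδ
    obtain ⟨z, hz⟩ := mem_range_lift hq ρ.2 hD hF (y := ⟨x, hx⟩)
      (hrange x hx (sphericalDisk_mono _ (min_le_right _ _) hxδ.2))
    have hzδ : (z : ℂ) ∈ expHalfPlane δ := by
      rw [← expPt_mem_sphericalDisk (a := U.base), ← hF, hz]
      exact hxδ.2
    exact ⟨⟨z, hzδ⟩, congrArg Subtype.val hz⟩
  have hZU : Z ⊆ U.nhd δ := by
    obtain ⟨x, hx⟩ := U.nonempty_nhd δ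
    exact U.subset_nhd hZc hZD ⟨x, hmemZ x (U.nhd_mono hδρ hx) (U.nhd_subset δ hx), hx⟩
  have hVδ : V.nhd δ ⊆ diskPreimage e Ψ U.base δ := hb ▸ V.nhd_subset δ
  have hVX : V.nhd δ ⊆ U.nhd ρ := by
    obtain ⟨x, hxU, hxV⟩ := not_disjoint_iff.1 (hmeet δ)
    exact U.subset_nhd (V.isPreconnected_nhd δ) (hVδ.trans (diskPreimage_mono _ hδρ))
      ⟨x, hxV, U.nhd_mono hρ₁ hxU⟩
  obtain ⟨x, hx⟩ := V.nonempty_nhd δ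
  exact ⟨x, V.nhd_mono (min_le_left _ _) hx,
    U.nhd_mono (min_le_left _ _) (hZU (hmemZ x (hVX hx) (hVδ hx)))⟩

/-- A germ over another point that meets all neighbourhoods of a logarithmic one is the germ of
a point of these neighbourhoods. -/
lemma exists_mem_of_isCoveringMap (hb : V.base ≠ U.base)
    (hbD : V.base ∈ sphericalDisk U.base ρ) (hmeet : ∀ ρ₂, ¬ Disjoint (U.nhd ρ) (V.nhd ρ₂)) :
    ∃ x ∈ U.nhd ρ, ∀ ρ₂, x ∈ V.nhd ρ₂ := by
  set b := V.base
  obtain ⟨r, hr, hrπ, hrD⟩ := exists_sphericalDisk_subset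
    (((isOpen_sphericalDisk U.base ρ).sdiff isClosed_singleton).mem_nhds
      (⟨hbD, hb⟩ : b ∈ sphericalDisk U.base ρ \ {U.base}))
  set R := Real.tan (r / 2)
  have hR : 0 < R := tan_half_pos hr hrπ
  have hVX : V.nhd ⟨r, hr⟩ ⊆ U.nhd ρ := by
    obtain ⟨x, hxU, hxV⟩ := not_disjoint_iff.1 (hmeet ⟨r, hr⟩)
    refine U.subset_nhd (V.isPreconnected_nhd _) (fun z hz ↦ ?_) ⟨x, hxV, hxU⟩
    have := V.nhd_subset _ hz
    exact ⟨this.1, (hrD this.2).1⟩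
  have hball : ∀ w : Metric.ball (0 : ℂ) R, centeredPt b w ∈ sphericalDisk b r := by
    intro w
    rw [sphericalDisk_eq_image hr hrπ]
    exact ⟨w, w.2, rfl⟩
  have hcoord : ∀ z ∈ V.nhd ⟨r, hr⟩, Ψ z ∈ range (centeredPt b) := fun z hz ↦
    sphericalDisk_subset_range hrπ.le (V.nhd_subset _ hz).2
  set κ := (isOpenEmbedding_centeredPt b).isEmbedding.toHomeomorph
  have hκ : ∀ t : range (centeredPt b), centeredPt b (κ.symm t) = t := fun t ↦
    congrArg Subtype.val (κ.apply_symm_apply t)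
  set c : V.nhd ⟨r, hr⟩ → ℂ := fun z ↦ κ.symm ⟨Ψ z, hcoord z z.2⟩
  have hc : ∀ z, centeredPt b (c z) = Ψ z := fun z ↦ hκ _
  have hcball : ∀ z, c z ∈ Metric.ball (0 : ℂ) R := by
    intro z
    have h1 : Ψ z ∈ sphericalDisk b r := (V.nhd_subset _ z.2).2
    rw [← hc z, centeredPt_mem_sphericalDisk, two_mul_arctan_lt_iff hr hrπ] at h1
    simpa using h1
  have hq := isLocalHomeomorph_of_isCoveringMap h hcov
  have hccont : Continuous c := by
    refine κ.symm.continuous.comp (Continuous.subtype_mk ?_ _)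
    exact hq.continuous.comp (continuous_subtype_val.subtype_mk fun z : V.nhd ⟨r, hr⟩ ↦ hVX z.2)
  have : ContractibleSpace (Metric.ball (0 : ℂ) R) := Metric.contractibleSpace_ball hR
  have : LocallyPathConnectedSpace (Metric.ball (0 : ℂ) R) :=
    Metric.isOpen_ball.locallyPathConnectedSpace
  obtain ⟨y, hy⟩ := V.nonempty_nhd ⟨r, hr⟩
  -- A small disk around `b` is simply connected and avoids the base of `U`, so it lifts to a
  -- section `τ` through a point of `V`. By uniqueness of lifts `V.nhd ⟨r, hr⟩` lies in the image of
  -- `τ`, and the common point is the lift of the centre.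
  obtain ⟨τ, ⟨hτy, hτ⟩, -⟩ := hcov.existsUnique_continuousMap_lifts
    ⟨fun w : Metric.ball (0 : ℂ) R ↦ ⟨centeredPt b w, hrD (hball w)⟩,
      ((continuous_centeredPt b).comp continuous_subtype_val).subtype_mk _⟩
    ⟨c ⟨y, hy⟩, hcball _⟩ ⟨y, hVX hy⟩ (Subtype.ext (hc ⟨y, hy⟩).symm)
  have hτΨ : ∀ w, Ψ (τ w) = centeredPt b w := fun w ↦ congrArg Subtype.val (congrFun hτ w)
  have : PreconnectedSpace (V.nhd ⟨r, hr⟩) :=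
    isPreconnected_iff_preconnectedSpace.1 (V.isPreconnected_nhd _)
  have heq : (fun z : V.nhd ⟨r, hr⟩ ↦ (⟨z, hVX z.2⟩ : U.nhd ρ)) =
      fun z ↦ τ ⟨c z, hcball z⟩ := by
    refine hcov.eq_of_comp_eq (continuous_subtype_val.subtype_mk _)
      (τ.continuous.comp (hccont.subtype_mk hcball)) (funext fun z ↦ Subtype.ext ?_) ⟨y, hy⟩
      hτy.symm
    change Ψ z = Ψ (τ ⟨c z, hcball z⟩)
    rw [hτΨ, hc]
  set x := τ ⟨0, Metric.mem_ball_self hR⟩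
  refine ⟨x, x.2, fun ρ₂ ↦ ?_⟩
  set δ : Ioi (0 : ℝ) := min ρ₂ ⟨r, hr⟩
  have hδr : (δ : ℝ) ≤ r := (min_le_right ρ₂ ⟨r, hr⟩ : δ ≤ ⟨r, hr⟩)
  have hδ0 : (0 : ℝ) < δ := δ.2
  have hδπ : (δ : ℝ) < Real.pi := lt_of_le_of_lt hδr hrπ
  have hinc : ∀ w : Metric.ball (0 : ℂ) (Real.tan (δ / 2)), (w : ℂ) ∈ Metric.ball (0 : ℂ) R := by
    intro w
    have h1 := w.2
    rw [mem_ball_zero_iff] at h1 ⊢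
    rw [← two_mul_arctan_lt_iff hδ0 hδπ] at h1
    exact (two_mul_arctan_lt_iff hr hrπ).1 (h1.trans_le hδr)
  refine V.nhd_mono (min_le_left _ _ : δ ≤ ρ₂) ?_
  have : PreconnectedSpace (Metric.ball (0 : ℂ) (Real.tan (δ / 2))) :=
    isPreconnected_iff_preconnectedSpace.1 Metric.isPreconnected_ball
  set T : Set S := range fun w : Metric.ball (0 : ℂ) (Real.tan (δ / 2)) ↦ (τ ⟨w, hinc w⟩ : S)
  have hT : IsPreconnected T := isPreconnected_range (continuous_subtype_val.comp
    (τ.continuous.comp (continuous_subtype_val.subtype_mk hinc)))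
  have hTD : T ⊆ diskPreimage e Ψ b δ := by
    rintro _ ⟨w, rfl⟩
    refine ⟨(U.nhd_subset ρ (τ _).2).1, ?_⟩
    rw [hτΨ, sphericalDisk_eq_image hδ0 hδπ]
    exact ⟨w, w.2, rfl⟩
  obtain ⟨z, hz⟩ := V.nonempty_nhd δ
  have hzr : z ∈ V.nhd ⟨r, hr⟩ := V.nhd_mono (min_le_right _ _) hz
  -- The section over the smaller disk meets `V.nhd δ`, so this component contains the whole
  -- connected set `T`, including the lift of `b`.
  have hzT : z ∈ T := by
    have h1 : Ψ z ∈ sphericalDisk b δ := (V.nhd_subset _ hz).2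
    rw [← hc ⟨z, hzr⟩, centeredPt_mem_sphericalDisk, two_mul_arctan_lt_iff hδ0 hδπ] at h1
    exact ⟨⟨c ⟨z, hzr⟩, by simpa using h1⟩, (congrArg Subtype.val (congrFun heq ⟨z, hzr⟩)).symm⟩
  exact V.subset_nhd hT hTD ⟨z, hzT, hz⟩ ⟨⟨0, Metric.mem_ball_self (tan_half_pos hδ0 hδπ)⟩, rfl⟩

end InverseGerm

/-! ### Logarithmic singularities are separate -/

section Surface

variable {S : Type*} [TopologicalSpace S] [ChartedSpace ℂ S] [IsManifold 𝓘(ℂ) 1 S]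
  [T2Space S] [ConnectedSpace S] {Ψ : S → OnePoint ℂ} {e : S}

namespace IsTranscendentalMeromorphic

variable (hΨ : IsTranscendentalMeromorphic e Ψ) {U : InverseGerm e Ψ}

include hΨ

/-- A logarithmic singularity is separate. -/
theorem isSeparate_of_isLogarithmic (hU : U.IsLogarithmic) : U.IsSeparate := by
  obtain ⟨-, ρ, h, hcov, -⟩ := hU
  have hρ : (0 : ℝ) < ρ := ρ.2
  -- Strictly smaller than `ρ`, so that a base point of `V` on the boundary of the disk of radius
  -- `r` is still inside the disk of radius `ρ`; the bound `1` keeps `r` below `π`.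
  set r : ℝ := min (ρ / 2) 1
  have hr : 0 < r := lt_min (by linarith) one_pos
  have hrρ : r < ρ := (min_le_left _ _).trans_lt (by linarith)
  have hrπ : r < Real.pi := (min_le_right _ _).trans_lt (by linarith [Real.pi_gt_three])
  have hle : (⟨r, hr⟩ : Ioi (0 : ℝ)) ≤ ρ := hrρ.le
  refine ⟨⟨r, hr⟩, fun V hV hVU ↦ ?_⟩
  by_contra! hmeet
  have hbr : sphericalDist V.base U.base ≤ r := by
    by_contra hcon
    obtain ⟨δ, hδ, -, hδC⟩ := exists_sphericalDisk_subset
      ((isClosed_sphericalDist_le U.base hr hrπ).isOpen_compl.mem_nhds hcon)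
    obtain ⟨y, hyU, hyV⟩ := not_disjoint_iff.1 (hmeet ⟨δ, hδ⟩)
    have h1 : sphericalDist (Ψ y) U.base < r := (U.nhd_subset _ hyU).2
    exact hδC (V.nhd_subset _ hyV).2 h1.le
  by_cases hb : V.base = U.base
  · exact hVU (InverseGerm.eq_of_isCoveringMap h hcov hb hle hrπ hmeet)
  obtain ⟨x, hxU, hx⟩ := InverseGerm.exists_mem_of_isCoveringMap h hcov hb
    (lt_of_le_of_lt hbr hrρ) fun ρ₂ hdis ↦ hmeet ρ₂ (hdis.mono_left (U.nhd_mono hle))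
  have hVx := hΨ.iInter_nhd_eq_singleton V hx
  rcases hV with ⟨z₁, hz₁, hcrit⟩ | hV
  · have hxz : x = z₁ := singleton_injective (hVx.symm.trans hz₁)
    subst hxz
    obtain ⟨φ, hφ, hφq⟩ := InverseGerm.isLocalHomeomorph_of_isCoveringMap h hcov ⟨x, hxU⟩
    refine hcrit.not_injOn ⟨Subtype.val '' φ.source, ?_, ?_⟩
    · exact (hΨ.isOpen_nhd U ρ).isOpenEmbedding_subtypeVal.isOpenMap.image_mem_nhds
        (φ.open_source.mem_nhds hφ)
    · rintro _ ⟨u, hu, rfl⟩ _ ⟨v, hv, rfl⟩ huv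
      have h1 : φ u = φ v := by rw [← hφq]; exact huv
      rw [φ.injOn hu hv h1]
  · rw [InverseGerm.IsTranscendental, hVx] at hV
    exact singleton_ne_empty _ hV

end IsTranscendentalMeromorphic

end Surface

end

theorem theorem1 {S : Type*} [TopologicalSpace S] [T2Space S] [ConnectedSpace S]
    [ChartedSpace ℂ S] [IsManifold 𝓘(ℂ) 1 S] (e : S) (Ψ : S → OnePoint ℂ)
    (hΨ : IsTranscendentalMeromorphic e Ψ) (U : InverseGerm e Ψ) (hU : U.IsSingularity)
    (he : U.IsTranscendental → U.AccumulatesAtEssential) :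
    U.IsSeparate ↔ U.IsAlgebraic ∨ U.IsLogarithmic := by
  constructor
  · intro hsep
    refine hU.imp id fun hT ↦ ?_
    exact hΨ.isLogarithmic_of_isSeparate hT (he hT) hsep
  · rintro (h | h)
    · exact hΨ.isSeparate_of_isAlgebraic h
    · exact hΨ.isSeparate_of_isLogarithmic h
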